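/- **Setting.** Let $\mathcal H=\mathbb C^n$ (an $n$-dimensional complex Hilbert space with a fixed orthonormal basis $e_1,\dots,e_n$), and let $\Gamma(\mathcal H)=\bigoplus_{k\ge 0}\mathcal H^{ⓢ k}$ be its boson Fock space, with inner product linear in the second variable. Multi-indices $\mathbf t,\mathbf s\in\mathbb Z_+^n$ are ordered entrywise, and $\mathbf t!$, $|\mathbf t|$, $\mathbf z^{\mathbf t}$, $\binom{\mathbf t}{\mathbf s}$ have their usual meaning. Let $|\mathbf t\rangle$ be the particle basis vector, i.e. the normalized symmetric tensor product of $e_r$ taken $t_r$ times ($r=1,\dots,n$). Let $|e(\mathbf z)\rangle=\bigoplus_k \mathbf z^{\otimes k}/\sqrt{k!}$ be the exponential vector at $\mathbf z\in\mathbb C^n$. Let $\mathcal F$ be the finite particle domain (vectors with finitely many nonzero components), which is the linear span of the $|\mathbf t\rangle$, and let $\mathcal E$ be the set of exponential vectors. A bounded operator $Z$ on $\Gamma(\mathcal H)$ is in $\mathcal E_2(\mathcal H)$ with parameters $(c,\boldsymbol\alpha,\boldsymbol\beta,A,\Lambda,B)$, where $c\in\mathbb C$, $\boldsymbol\alpha,\boldsymbol\beta\in\mathbb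 C^n$, $A,\Lambda,B\in M_n(\mathbb C)$ and $A=A^T$, $B=B^T$, if for all $\mathbf u,\mathbf v\in\mathbb C^n$ $$\langle e(\bar{\mathbf u})|Z|e(\mathbf v)\rangle=c\,\exp\{\mathbf u^T\boldsymbol\alpha+\boldsymbol\beta^T\mathbf v+\mathbf u^TA\mathbf u+\mathbf u^T\Lambda\mathbf v+\mathbf v^TB\mathbf v\}.$$ A positive $Z$ is said to have parameters $(c,\boldsymbol\mu,A,\Lambda)$, with $c>0$, if it has parameters $(c,\boldsymbol\mu,\bar{\boldsymbol\mu},A,\Lambda,\bar A)$. For $B\in M_n(\mathbb C)$ and $\mathbf t\in\mathbb Z_+^n$ put $$\varphi_B(\mathbf t)=\sqrt{\mathbf t!}\sum_{R\in\Delta(\mathbf t)}2^{\,\sum_{i<j}r_{ij}}\prod_{i\le j}\frac{b_{ij}^{r_{ij}}}{r_{ij}!},$$ where $\Delta(\mathbf t)$ is the finite set of upper triangular $R=[r_{ij}]\in M_n(\mathbb Z_+)$ with $\sum_{j\le i}r_{ji}+\sum_{j\ge i}r_{ij}=t_i$ for all $i$. With $a_1,\dots,a_n$ the annihilation operators of the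 $n$ modes, the linear operators $\Gamma(B)$ and $\exp\{\boldsymbol\mu^T\boldsymbol a+\boldsymbol a^TB\boldsymbol a\}$ on $\mathcal F$ are defined by $\Gamma(B)=B^{\otimes k}$ on $\mathcal H^{ⓢ k}$ and $$\exp\{\boldsymbol\mu^T\boldsymbol a+\boldsymbol a^TB\boldsymbol a\}\frac{|\mathbf t\rangle}{\sqrt{\mathbf t!}}=\sum_{\mathbf k\le\mathbf s\le\mathbf t}\frac{\boldsymbol\mu^{\mathbf k}}{\mathbf k!}\frac{\varphi_B(\mathbf s-\mathbf k)}{\sqrt{(\mathbf s-\mathbf k)!}}\frac{|\mathbf t-\mathbf s\rangle}{\sqrt{(\mathbf t-\mathbf s)!}}.$$ **Theorem.** Let $Z\ge 0$ be in $\mathcal E_2(\mathcal H)$ with parameters $(c,\boldsymbol\mu,A,\Lambda)$, $c>0$. Then $\Lambda\ge0$, and there is exactly one linear operator $$Z_1=\sqrt c\,\Gamma(\sqrt\Lambda)\exp\{\bar{\boldsymbol\mu}^T\boldsymbol a+\boldsymbol a^T\bar A\boldsymbol a\}$$ with domain $\operatorname{span}(\mathcal F\cup\mathcal E)$ which on $\mathcal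 F$ is the composition of the operators defined above and which on $\mathcal E$ is given by $$Z_1|e(\mathbf z)\rangle=\sqrt c\,\exp\{\bar{\boldsymbol\mu}^T\mathbf z+\mathbf z^T\bar A\mathbf z\}\,|e(\sqrt\Lambda\,\mathbf z)\rangle\qquad(\mathbf z\in\mathbb C^n).$$ Moreover: 1. $Z_1$ is closable and its closure is a bounded operator on $\Gamma(\mathcal H)$, again denoted $Z_1$. It belongs to $\mathcal E_2(\mathcal H)$ with parameters $(\sqrt c,0,\bar{\boldsymbol\mu},0,\sqrt\Lambda,\bar A)$. 2. $Z=Z_1^\dagger Z_1$. 3. There is a partial isometry $V$ with $Z_1=V\sqrt Z$. Moreover, $Z$ is trace class if and only if $Z_1$ is Hilbert–Schmidt. 4. Suppose $\boldsymbol\mu=0$. Then for all $\mathbf t,\mathbf t'\in\mathbb Z_+^n$ $$Z_1|\mathbf t\rangle=\sqrt c\sum_{\mathbf s\le\mathbf t}\sqrt{\tbinom{\mathbf t}{\mathbf s}}\,\varphi_{\bar A}(\mathbf t-\mathbf s)\,\sqrt\Lambda^{\otimes|\mathbf s|}|\mathbf s\rangle,$$ $$\langle\mathbf t|Z|\mathbf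 t'\rangle=c\sum_{\substack{\mathbf s\le\mathbf t,\ \mathbf s'\le\mathbf t'\\|\mathbf s|=|\mathbf s'|}}\sqrt{\tbinom{\mathbf t}{\mathbf s}}\,\varphi_A(\mathbf t-\mathbf s)\,\langle\mathbf s|\Lambda^{\otimes|\mathbf s|}|\mathbf s'\rangle\,\sqrt{\tbinom{\mathbf t'}{\mathbf s'}}\;\overline{\varphi_A(\mathbf t'-\mathbf s')}.$$ Equivalently, the matrices in the particle basis satisfy $[Z]=c\,[E_A][\Gamma(\Lambda)][E_A]^\dagger$, where $E_A(\mathbf t,\mathbf s)=\sqrt{\binom{\mathbf t}{\mathbf s}}\,\varphi_A(\mathbf t-\mathbf s)$ if $\mathbf s\le\mathbf t$ and $E_A(\mathbf t,\mathbf s)=0$ otherwise. -/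

import Mathlib

open scoped Matrix ComplexOrder MatrixOrder InnerProductSpace

noncomputable section

namespace BosonFock

open scoped Nat

/-! ### Multi-indices -/

/-- Multi-indices `(t₁, …, tₙ)` of nonnegative integers, ordered entrywise. -/
abbrev MultiIndex (n : ℕ) : Type := Fin n → ℕ

/-- `|t| = t₁ + ⋯ + tₙ`. -/
def deg {n : ℕ} (t : MultiIndex n) : ℕ := ∑ i, t i

/-- `t! = t₁! ⋯ tₙ!`. -/
def mfact {n : ℕ} (t : MultiIndex n) : ℕ := ∏ i, (t i)!

/-- `z ^ t = z₁ ^ t₁ ⋯ zₙ ^ tₙ`. -/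
def mpow {n : ℕ} (z : Fin n → ℂ) (t : MultiIndex n) : ℂ := ∏ i, z i ^ t i

/-- The multi-index binomial coefficient (it vanishes unless `s ≤ t`). -/
def mchoose {n : ℕ} (t s : MultiIndex n) : ℕ := ∏ i, (t i).choose (s i)

/-! ### The function `φ_B` -/

/-- `R` is upper triangular. -/
def IsUpper {n : ℕ} (R : Matrix (Fin n) (Fin n) ℕ) : Prop := ∀ i j, j < i → R i j = 0

/-- `r̃ᵢ = ∑_{j ≤ i} r_{ji} + ∑_{j ≥ i} r_{ij}` (diagonal entries are counted twice). -/
def rowColSum {n : ℕ} (R : Matrix (Fin n) (Fin n) ℕ) : MultiIndex n :=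
  fun i => ∑ j ∈ Finset.Iic i, R j i + ∑ j ∈ Finset.Ici i, R i j

open Classical in
/-- The finite set `Δ(t)` of upper triangular `R` with `r̃(R) = t`. -/
def upperIndices {n : ℕ} (t : MultiIndex n) : Finset (Matrix (Fin n) (Fin n) ℕ) :=
  ((Finset.Iic (fun i (_ : Fin n) => t i : Fin n → Fin n → ℕ)).map Matrix.of.toEmbedding).filter
    (fun R => IsUpper R ∧ rowColSum R = t)

open Classical in
theorem mem_upperIndices {n : ℕ} (t : MultiIndex n) (R : Matrix (Fin n) (Fin n) ℕ) :
    R ∈ upperIndices t ↔ IsUpper R ∧ rowColSum R = t := by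
  unfold upperIndices
  rw [Finset.mem_filter, Finset.mem_map]
  refine ⟨fun h => h.2, fun h => ⟨⟨fun i j => R i j, Finset.mem_Iic.2 ?_, rfl⟩, h⟩⟩
  intro i j
  show R i j ≤ t i
  rcases lt_or_ge j i with hji | hij
  · rw [h.1 i j hji]
    exact Nat.zero_le _
  · rw [← h.2]
    refine le_trans ?_ (Nat.le_add_left _ _)
    exact Finset.single_le_sum (f := fun j => R i j) (fun _ _ => Nat.zero_le _)
      (Finset.mem_Ici.2 hij)

/-- `φ_B(t) = √(t!) ∑_{R ∈ Δ(t)} 2^{|R| - tr R} ∏ b_{ij}^{r_{ij}} / R!`. -/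
def phi {n : ℕ} (B : Matrix (Fin n) (Fin n) ℂ) (t : MultiIndex n) : ℂ :=
  (√(mfact t : ℝ) : ℂ) * ∑ R ∈ upperIndices t,
    (2 : ℂ) ^ ((∑ i, ∑ j, R i j) - R.trace) * (∏ i, ∏ j, B i j ^ R i j) /
      ((∏ i, ∏ j, (R i j)! : ℕ) : ℂ)

/-! ### Symmetric tensor powers of `ℂⁿ` and the Fock space

A tensor of order `k` over `ℂⁿ` is given by its coordinates, indexed by `Fin k → Fin n`. -/

/-- The symmetric tensors of order `k` over `ℂⁿ`, as a subspace of the full tensor power. -/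
def symTensor (n k : ℕ) : Submodule ℂ (EuclideanSpace ℂ (Fin k → Fin n)) where
  carrier := {ψ | ∀ (σ : Equiv.Perm (Fin k)) (i : Fin k → Fin n), ψ (i ∘ σ) = ψ i}
  add_mem' := by
    intro a b ha hb σ i
    simp [ha σ i, hb σ i]
  zero_mem' := by
    intro σ i
    simp
  smul_mem' := by
    intro c a ha σ i
    simp [ha σ i]

instance (n k : ℕ) : CompleteSpace (symTensor n k) :=
  FiniteDimensional.complete ℂ (symTensor n k)

/-- The boson Fock space `Γ(ℂⁿ) = ⨁ₖ (ℂⁿ)^{ⓢk}` (Hilbert space direct sum). -/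
def Fock (n : ℕ) : Type := lp (fun k : ℕ => symTensor n k) 2

instance (n : ℕ) : NormedAddCommGroup (Fock n) :=
  inferInstanceAs (NormedAddCommGroup (lp (fun k : ℕ => symTensor n k) 2))

instance (n : ℕ) : InnerProductSpace ℂ (Fock n) :=
  inferInstanceAs (InnerProductSpace ℂ (lp (fun k : ℕ => symTensor n k) 2))

instance (n : ℕ) : CompleteSpace (Fock n) :=
  inferInstanceAs (CompleteSpace (lp (fun k : ℕ => symTensor n k) 2))

/-- The vector of the Fock space with the given square-summable components. -/
def Fock.mk {n : ℕ} (f : ∀ k : ℕ, symTensor n k) (hf : Summable fun k => ‖f k‖ ^ 2) : Fock n :=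
  (⟨f, memℓp_gen (by simpa using hf)⟩ : lp (fun k : ℕ => symTensor n k) 2)

/-- The component of order `k` of a vector of the Fock space. -/
def comp {n : ℕ} (k : ℕ) : Fock n →ₗ[ℂ] symTensor n k where
  toFun ψ := (show lp (fun k : ℕ => symTensor n k) 2 from ψ) k
  map_add' _ _ := rfl
  map_smul' _ _ := rfl

/-- The inclusion of the symmetric tensors of order `k` in the Fock space. -/
def incl {n : ℕ} (k : ℕ) : symTensor n k →ₗ[ℂ] Fock n where
  toFun w := (lp.single 2 k w : lp (fun k : ℕ => symTensor n k) 2)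
  map_add' a b := map_add (lp.singleAddMonoidHom (E := fun k : ℕ => symTensor n k) 2 k) a b
  map_smul' c w := lp.single_smul (E := fun k : ℕ => symTensor n k) 2 k c w

theorem comp_mk {n : ℕ} (f : ∀ k : ℕ, symTensor n k) (hf : Summable fun k => ‖f k‖ ^ 2)
    (k : ℕ) : comp k (Fock.mk f hf) = f k := rfl

theorem comp_incl_self {n : ℕ} (k : ℕ) (w : symTensor n k) : comp k (incl k w) = w :=
  lp.single_apply_self (E := fun k : ℕ => symTensor n k) 2 k w

theorem comp_incl_ne {n k m : ℕ} (w : symTensor n k) (h : m ≠ k) : comp m (incl k w) = 0 :=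
  lp.single_apply_ne (E := fun k : ℕ => symTensor n k) 2 k w h

theorem Fock.ext {n : ℕ} {ψ χ : Fock n} (h : ∀ k, comp k ψ = comp k χ) : ψ = χ :=
  lp.ext (E := fun k : ℕ => symTensor n k) (funext h)

/-- `z^{⊗k}`. -/
def vecPow {n : ℕ} (z : Fin n → ℂ) (k : ℕ) : symTensor n k :=
  ⟨WithLp.toLp 2 (fun i => ∏ l, z (i l)), by
    intro σ i
    exact Equiv.prod_comp σ (fun l => z (i l))⟩

/-- `B^{⊗k}` on the full tensor power. -/
def tensorPow {n : ℕ} (B : Matrix (Fin n) (Fin n) ℂ) (k : ℕ) :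
    EuclideanSpace ℂ (Fin k → Fin n) →ₗ[ℂ] EuclideanSpace ℂ (Fin k → Fin n) where
  toFun ψ := WithLp.toLp 2 (fun i => ∑ j, (∏ l, B (i l) (j l)) * ψ j)
  map_add' := by
    intro a b
    ext i
    simp [mul_add, Finset.sum_add_distrib]
  map_smul' := by
    intro c a
    ext i
    simp [Finset.mul_sum, mul_left_comm]

/-- The restriction of `B^{⊗k}` to the symmetric tensors. -/
def symPow {n : ℕ} (B : Matrix (Fin n) (Fin n) ℂ) (k : ℕ) :
    symTensor n k →ₗ[ℂ] symTensor n k :=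
  (tensorPow B k).restrict (by
    intro ψ hψ σ i
    show ∑ j, (∏ l, B ((i ∘ σ) l) (j l)) * ψ j = ∑ j, (∏ l, B (i l) (j l)) * ψ j
    rw [← Equiv.sum_comp (Equiv.arrowCongr σ.symm (Equiv.refl (Fin n)))]
    refine Finset.sum_congr rfl fun j _ => ?_
    have h1 : (Equiv.arrowCongr σ.symm (Equiv.refl (Fin n))) j = j ∘ σ := by
      ext l
      simp [Equiv.arrowCongr]
    rw [h1, hψ σ j]
    congr 1
    exact Equiv.prod_comp σ (fun l => B (i l) (j l)))

/-! ### The particle basis -/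

/-- The occupation numbers of a sequence of modes. -/
def occ {n k : ℕ} (i : Fin k → Fin n) : MultiIndex n :=
  fun r => (Finset.univ.filter (fun l => i l = r)).card

theorem occ_comp {n k : ℕ} (i : Fin k → Fin n) (σ : Equiv.Perm (Fin k)) :
    occ (i ∘ σ) = occ i := by
  funext r
  refine Finset.card_bij (fun l _ => σ l) ?_ ?_ ?_
  · intro l hl
    simpa using hl
  · intro a _ b _ h
    exact σ.injective h
  · intro b hb
    exact ⟨σ.symm b, by simpa using hb, by simp⟩

theorem deg_occ {n k : ℕ} (i : Fin k → Fin n) : deg (occ i) = k := by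
  unfold deg occ
  rw [← Finset.card_eq_sum_card_fiberwise (f := i) (s := Finset.univ) (t := Finset.univ)
    (fun _ _ => Finset.mem_coe.2 (Finset.mem_univ _))]
  simp

theorem exists_perm_of_occ_eq {n k : ℕ} (i j : Fin k → Fin n) (h : occ i = occ j) :
    ∃ σ : Equiv.Perm (Fin k), j ∘ σ = i := by
  have hc : ∀ r, Nonempty ({l // i l = r} ≃ {l // j l = r}) := by
    intro r
    refine Fintype.card_eq.1 ?_
    rw [Fintype.card_subtype, Fintype.card_subtype]
    exact congrFun h r
  refine ⟨Equiv.ofFiberEquiv (fun r => (hc r).some), ?_⟩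
  funext l
  exact Equiv.ofFiberEquiv_map (fun r => (hc r).some) l

theorem exists_occ_eq {n : ℕ} (t : MultiIndex n) : ∃ i : Fin (deg t) → Fin n, occ i = t := by
  let e : Fin (deg t) ≃ (Σ r : Fin n, Fin (t r)) := Fintype.equivOfCardEq (by simp only [Fintype.card_sigma, Fintype.card_fin]; rfl)
  refine ⟨fun l => (e l).1, ?_⟩
  funext r
  unfold occ
  have h1 : (Finset.univ.filter (fun l => (e l).1 = r)).card
      = (Finset.univ : Finset (Fin (t r))).card := by
    symm
    refine Finset.card_bij (fun a _ => e.symm ⟨r, a⟩) ?_ ?_ ?_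
    · intro a _
      simp
    · intro a _ b _ hab
      simpa using hab
    · intro l hl
      obtain ⟨⟨r', a⟩, rfl⟩ := e.symm.surjective l
      have : r' = r := by simpa using hl
      subst this
      exact ⟨a, Finset.mem_univ _, rfl⟩
  rw [h1]
  simp

/-- The normalized symmetric tensor product of `e_r` taken `t_r` times, for `|t| = k`: its
coordinates are `√(t!/k!)` at the sequences of modes with occupation numbers `t`, else `0`. -/
def ketSym {n : ℕ} (k : ℕ) (t : MultiIndex n) : symTensor n k :=
  ⟨WithLp.toLp 2 (fun i => if occ i = t then (√((mfact t : ℝ) / (k ! : ℝ)) : ℂ) else 0), by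
    intro σ i
    show (if occ (i ∘ σ) = t then _ else _) = (if occ i = t then _ else _)
    rw [occ_comp]⟩

/-- The particle basis vector `|t⟩`, in the summand of order `|t|`. -/
def ket {n : ℕ} (t : MultiIndex n) : Fock n := incl (deg t) (ketSym (deg t) t)

/-- The finite particle domain: vectors with finitely many nonzero components. -/
def finiteParticle (n : ℕ) : Submodule ℂ (Fock n) where
  carrier := {ψ | {k : ℕ | comp k ψ ≠ 0}.Finite}
  add_mem' := by
    intro a b ha hb
    refine (Set.Finite.union ha hb).subset ?_
    intro k hk
    by_contra hcon
    simp only [Set.mem_union, Set.mem_ofPred_eq, not_or, not_not] at hcon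
    exact hk (by rw [map_add, hcon.1, hcon.2, add_zero])
  zero_mem' := by simp
  smul_mem' := by
    intro c a ha
    refine Set.Finite.subset ha ?_
    intro k hk hcon
    exact hk (by rw [map_smul, hcon, smul_zero])

theorem incl_mem_finiteParticle {n : ℕ} (k : ℕ) (w : symTensor n k) :
    incl k w ∈ finiteParticle n := by
  refine (Set.finite_singleton k).subset ?_
  intro m hm
  by_contra hne
  exact hm (comp_incl_ne w (fun h => hne h))

/-- `|t⟩` as an element of the finite particle domain. -/
def ketF {n : ℕ} (t : MultiIndex n) : finiteParticle n :=
  ⟨ket t, incl_mem_finiteParticle _ _⟩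

theorem ketCoeff_ne_zero {n : ℕ} (k : ℕ) (t : MultiIndex n) :
    (√((mfact t : ℝ) / (k ! : ℝ)) : ℂ) ≠ 0 := by
  have h1 : (0 : ℝ) < mfact t := by
    unfold mfact
    exact_mod_cast Finset.prod_pos fun i _ => Nat.factorial_pos (t i)
  have h2 : (0 : ℝ) < (k ! : ℝ) := by exact_mod_cast Nat.factorial_pos k
  exact_mod_cast (Real.sqrt_pos.2 (div_pos h1 h2)).ne'

/-- The coordinate of a Fock space vector at a sequence of `k` modes. -/
def coord {n k : ℕ} (i : Fin k → Fin n) : Fock n →ₗ[ℂ] ℂ :=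
  (EuclideanSpace.proj i : EuclideanSpace ℂ (Fin k → Fin n) →L[ℂ] ℂ).toLinearMap ∘ₗ
    (symTensor n k).subtype ∘ₗ comp k

theorem coord_ket {n k : ℕ} (i : Fin k → Fin n) (t : MultiIndex n) :
    coord i (ket t) = if occ i = t then (√((mfact t : ℝ) / (k ! : ℝ)) : ℂ) else 0 := by
  by_cases hd : k = deg t
  · subst hd
    show ((comp (deg t) (incl (deg t) (ketSym (deg t) t)) : symTensor n (deg t)) :
      EuclideanSpace ℂ (Fin (deg t) → Fin n)) i = _
    rw [comp_incl_self]
    rfl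
  · rw [if_neg (fun h => hd (by rw [← h, deg_occ]))]
    show ((comp k (incl (deg t) (ketSym (deg t) t)) : symTensor n k) :
      EuclideanSpace ℂ (Fin k → Fin n)) i = 0
    rw [comp_incl_ne _ hd]
    rfl

theorem linearIndependent_ketF (n : ℕ) : LinearIndependent ℂ (ketF (n := n)) := by
  rw [linearIndependent_iff']
  intro s g hg t ht
  obtain ⟨i, hi⟩ := exists_occ_eq t
  have h1 : ∑ u ∈ s, g u • ket u = 0 := by
    have := congrArg (Submodule.subtype (finiteParticle n)) hg
    simpa [ketF] using this
  have h2 := congrArg (coord i) h1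
  simp only [map_sum, map_smul, map_zero, coord_ket, hi] at h2
  rw [Finset.sum_eq_single t (fun u _ hu => by rw [if_neg hu.symm, smul_zero])
    (fun h => absurd ht h), if_pos rfl, smul_eq_mul] at h2
  exact (mul_eq_zero.1 h2).resolve_right (ketCoeff_ne_zero _ _)

theorem incl_mem_span_ket {n : ℕ} (k : ℕ) (w : symTensor n k) :
    incl k w ∈ Submodule.span ℂ (Set.range (ket (n := n))) := by
  classical
  let a : MultiIndex n → ℂ := fun t =>
    if h : ∃ i : Fin k → Fin n, occ i = t then
      (w : EuclideanSpace ℂ (Fin k → Fin n)) h.choose / (√((mfact t : ℝ) / (k ! : ℝ)) : ℂ)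
    else 0
  have hw : w = ∑ t ∈ Finset.univ.image (occ (n := n) (k := k)), a t • ketSym k t := by
    ext i
    simp only [Submodule.coe_sum, WithLp.ofLp_sum, Finset.sum_apply]
    have hterm : ∀ t, ((a t • ketSym k t : symTensor n k) :
        EuclideanSpace ℂ (Fin k → Fin n)) i
        = a t * (if occ i = t then (√((mfact t : ℝ) / (k ! : ℝ)) : ℂ) else 0) := fun t => rfl
    rw [Finset.sum_eq_single (occ i)]
    · rw [hterm, if_pos rfl]
      have hex : ∃ j : Fin k → Fin n, occ j = occ i := ⟨i, rfl⟩
      have ha : a (occ i) = (w : EuclideanSpace ℂ (Fin k → Fin n)) hex.choose /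
          (√((mfact (occ i) : ℝ) / (k ! : ℝ)) : ℂ) := dif_pos hex
      rw [ha, div_mul_cancel₀ _ (ketCoeff_ne_zero _ _)]
      obtain ⟨σ, hσ⟩ := exists_perm_of_occ_eq _ _ hex.choose_spec
      have := w.2 σ i
      rw [hσ] at this
      exact this.symm
    · intro t _ ht
      rw [hterm, if_neg (fun h => ht h.symm), mul_zero]
    · intro h
      exact absurd (Finset.mem_image_of_mem _ (Finset.mem_univ i)) h
  rw [hw, map_sum]
  refine Submodule.sum_mem _ fun t ht => ?_
  rw [map_smul]
  refine Submodule.smul_mem _ _ (Submodule.subset_span ?_)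
  obtain ⟨i, _, rfl⟩ := Finset.mem_image.1 ht
  refine ⟨occ i, ?_⟩
  unfold ket
  rw [deg_occ]

theorem span_ketF (n : ℕ) : ⊤ ≤ Submodule.span ℂ (Set.range (ketF (n := n))) := by
  rintro ⟨ψ, hψ⟩ -
  have hfin : {k : ℕ | comp k ψ ≠ 0}.Finite := hψ
  have h1 : ψ = ∑ k ∈ hfin.toFinset, incl k (comp k ψ) := by
    refine Fock.ext fun m => ?_
    rw [map_sum]
    by_cases hm : comp m ψ = 0
    · rw [hm]
      symm
      refine Finset.sum_eq_zero fun k hk => comp_incl_ne _ ?_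
      rintro rfl
      exact (hfin.mem_toFinset.1 hk) hm
    · rw [Finset.sum_eq_single m (fun k _ hk => comp_incl_ne _ hk.symm)
        (fun h => absurd (hfin.mem_toFinset.2 hm) h), comp_incl_self]
  have h2 : ψ ∈ Submodule.span ℂ (Set.range (ket (n := n))) := by
    rw [h1]
    exact Submodule.sum_mem _ fun k _ => incl_mem_span_ket k (comp k ψ)
  have h3 : Set.range (ket (n := n))
      = (finiteParticle n).subtype '' Set.range (ketF (n := n)) := by
    rw [← Set.range_comp]
    rfl
  rw [h3, ← Submodule.map_span] at h2
  obtain ⟨y, hy, hyψ⟩ := h2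
  have : y = ⟨ψ, hψ⟩ := Subtype.ext hyψ
  rwa [this] at hy

/-- The particle basis vectors form an algebraic basis of the finite particle domain. -/
def ketBasis (n : ℕ) : Module.Basis (MultiIndex n) ℂ (finiteParticle n) :=
  Module.Basis.mk (linearIndependent_ketF n) (span_ketF n)

/-! ### Operators on the finite particle domain -/

/-- `Γ(B)` on the finite particle domain: `B^{⊗k}` on the symmetric tensors of order `k`. -/
def secondQuant {n : ℕ} (B : Matrix (Fin n) (Fin n) ℂ) :
    finiteParticle n →ₗ[ℂ] finiteParticle n where
  toFun ψ := ⟨Fock.mk (fun k => symPow B k (comp k (ψ : Fock n))) (by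
      refine summable_of_hasFiniteSupport (Set.Finite.subset ψ.2 ?_)
      intro k hk hcon
      exact hk (by simp only [hcon, map_zero, norm_zero]; norm_num)), by
      refine Set.Finite.subset ψ.2 ?_
      intro k hk hcon
      exact hk (by rw [comp_mk, hcon, map_zero])⟩
  map_add' := by
    intro a b
    refine Subtype.ext (Fock.ext fun k => ?_)
    exact map_add (symPow B k ∘ₗ comp k) _ _
  map_smul' := by
    intro c a
    refine Subtype.ext (Fock.ext fun k => ?_)
    exact map_smul (symPow B k ∘ₗ comp k) c _

/-- `exp(μᵀa + aᵀBa)` on the finite particle domain, where `a₁, …, aₙ` are the annihilation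
operators of the modes: the linear map with
`|t⟩ / √t! ↦ ∑_{k ≤ s ≤ t} (μ^k / k!) (φ_B(s-k) / √(s-k)!) |t-s⟩ / √(t-s)!`. -/
def annihExp {n : ℕ} (μ : Fin n → ℂ) (B : Matrix (Fin n) (Fin n) ℂ) :
    finiteParticle n →ₗ[ℂ] finiteParticle n :=
  (ketBasis n).constr ℂ (fun t =>
    (√(mfact t : ℝ) : ℂ) • ∑ s ∈ Finset.Iic t, ∑ k ∈ Finset.Iic s,
      ((mpow μ k / (mfact k : ℂ)) * (phi B (s - k) / (√(mfact (s - k) : ℝ) : ℂ)) /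
        (√(mfact (t - s) : ℝ) : ℂ)) • ketF (t - s))

/-! ### Exponential vectors and generating functions -/

theorem norm_vecPow {n : ℕ} (z : Fin n → ℂ) (k : ℕ) :
    ‖vecPow z k‖ ^ 2 = (∑ r, ‖z r‖ ^ 2) ^ k := by
  rw [Submodule.coe_norm, EuclideanSpace.norm_sq_eq]
  have h1 : ∀ i : Fin k → Fin n, ‖(vecPow z k : EuclideanSpace ℂ (Fin k → Fin n)) i‖ ^ 2
      = ∏ l, ‖z (i l)‖ ^ 2 := by
    intro i
    show ‖∏ l, z (i l)‖ ^ 2 = _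
    rw [norm_prod, Finset.prod_pow]
  rw [Finset.sum_congr rfl (fun i _ => h1 i)]
  have h2 := Finset.prod_univ_sum (fun _ : Fin k => (Finset.univ : Finset (Fin n)))
    (fun _ r => ‖z r‖ ^ 2)
  simp only [Finset.prod_const, Finset.card_univ, Fintype.card_fin,
    Fintype.piFinset_univ] at h2
  exact h2.symm

/-- The exponential vector `e(z) = ⨁ₖ z^{⊗k} / √k!`. -/
def expVec {n : ℕ} (z : Fin n → ℂ) : Fock n :=
  Fock.mk (fun k => ((√(k ! : ℝ) : ℂ)⁻¹) • vecPow z k) (by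
    have h1 : ∀ k : ℕ, ‖((√(k ! : ℝ) : ℂ)⁻¹) • vecPow z k‖ ^ 2
        = (∑ r, ‖z r‖ ^ 2) ^ k / (k ! : ℝ) := by
      intro k
      rw [norm_smul, mul_pow, norm_vecPow, norm_inv, Complex.norm_real,
        Real.norm_of_nonneg (Real.sqrt_nonneg _), inv_pow, Real.sq_sqrt (Nat.cast_nonneg _)]
      ring
    simp only [h1]
    exact Real.summable_pow_div_factorial _)

/-- The generating function `G_Z(u, v) = ⟨e(ū), Z e(v)⟩`. -/
def genFun {n : ℕ} (Z : Fock n →L[ℂ] Fock n) (u v : Fin n → ℂ) : ℂ :=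
  ⟪expVec (star u), Z (expVec v)⟫_ℂ

/-- The bounded operator `Z` belongs to the class `𝓔₂(ℂⁿ)`, with parameters
`(c, α, β, A, Λ, B)`. -/
structure HasE2Params {n : ℕ} (Z : Fock n →L[ℂ] Fock n) (c : ℂ) (α β : Fin n → ℂ)
    (A Λ B : Matrix (Fin n) (Fin n) ℂ) : Prop where
  symm_A : A.IsSymm
  symm_B : B.IsSymm
  genFun_eq : ∀ u v : Fin n → ℂ, genFun Z u v =
    c * Complex.exp (u ⬝ᵥ α + β ⬝ᵥ v + u ⬝ᵥ (A *ᵥ u) + u ⬝ᵥ (Λ *ᵥ v) + v ⬝ᵥ (B *ᵥ v))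

/-- Entrywise complex conjugate of a matrix. -/
def conjMat {n : ℕ} (A : Matrix (Fin n) (Fin n) ℂ) : Matrix (Fin n) (Fin n) ℂ :=
  A.map (starRingEnd ℂ)

/-- `T` is the operator `√c Γ(√Λ) exp(μ̄ᵀa + aᵀĀa)` whose domain is the span of the finite
particle vectors and the exponential vectors. -/
structure IsWickOperator {n : ℕ} (c : ℝ) (μ : Fin n → ℂ) (A Λ : Matrix (Fin n) (Fin n) ℂ)
    (T : Fock n →ₗ.[ℂ] Fock n) : Prop where
  domain_eq : T.domain =
    Submodule.span ℂ ((finiteParticle n : Set (Fock n)) ∪ Set.range (expVec (n := n)))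
  on_finiteParticle : ∀ (ψ : finiteParticle n) (h : (ψ : Fock n) ∈ T.domain),
    T ⟨ψ, h⟩ = (√c : ℂ) •
      (secondQuant (CFC.sqrt Λ) (annihExp (star μ) (conjMat A) ψ) : Fock n)
  on_expVec : ∀ (z : Fin n → ℂ) (h : expVec z ∈ T.domain),
    T ⟨expVec z, h⟩ = (√c : ℂ) •
      Complex.exp (star μ ⬝ᵥ z + z ⬝ᵥ (conjMat A *ᵥ z)) • expVec (CFC.sqrt Λ *ᵥ z)

/-! ### Matrices in the particle basis -/

/-- `B^{⊗|s|} |s⟩`, a vector of the summand of order `|s|`. -/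
def powKet {n : ℕ} (B : Matrix (Fin n) (Fin n) ℂ) (s : MultiIndex n) : Fock n :=
  incl (deg s) (symPow B (deg s) (ketSym (deg s) s))

/-- The matrix `⟨t, T t'⟩` of an operator `T` defined on the finite particle domain. -/
def particleMatrix {n : ℕ} (T : finiteParticle n →ₗ[ℂ] Fock n) :
    Matrix (MultiIndex n) (MultiIndex n) ℂ :=
  Matrix.of fun t t' => ⟪ket t, T (ketF t')⟫_ℂ

/-- The matrix `[Z]` of a bounded operator. -/
def boundedMatrix {n : ℕ} (Z : Fock n →L[ℂ] Fock n) :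
    Matrix (MultiIndex n) (MultiIndex n) ℂ :=
  particleMatrix (Z.toLinearMap ∘ₗ (finiteParticle n).subtype)

/-- The matrix `[Γ(B)]`. -/
def gammaMatrix {n : ℕ} (B : Matrix (Fin n) (Fin n) ℂ) :
    Matrix (MultiIndex n) (MultiIndex n) ℂ :=
  particleMatrix ((finiteParticle n).subtype ∘ₗ secondQuant B)

open Classical in
/-- The matrix `[E_A]`. -/
def eMatrix {n : ℕ} (A : Matrix (Fin n) (Fin n) ℂ) :
    Matrix (MultiIndex n) (MultiIndex n) ℂ :=
  Matrix.of fun t s => if s ≤ t then (√(mchoose t s : ℝ) : ℂ) * phi A (t - s) else 0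

/-- The product of two infinite matrices (used only where the sums are finite). -/
def infMul {I : Type} (M N : Matrix I I ℂ) : Matrix I I ℂ :=
  Matrix.of fun t s => ∑' r, M t r * N r s

/-! ### Operator-theoretic notions -/

section Operators

universe u

variable {E : Type u} [NormedAddCommGroup E] [InnerProductSpace ℂ E] [CompleteSpace E]

/-- `V` is isometric on the orthogonal complement of its kernel. -/
def IsPartialIsometry (V : E →L[ℂ] E) : Prop :=
  ∀ x ∈ (LinearMap.ker V.toLinearMap)ᗮ, ‖V x‖ = ‖x‖

/-- `∑ ‖T bᵢ‖² < ∞` for the orthonormal bases `b` of the space. -/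
def IsHilbertSchmidt (T : E →L[ℂ] E) : Prop :=
  ∀ (ι : Type u) (b : HilbertBasis ι ℂ E), Summable fun i => ‖T (b i)‖ ^ 2

/-- `tr |T| = ∑ ⟨bᵢ, |T| bᵢ⟩ < ∞`, with `|T| = √(T†T)`, for the orthonormal bases `b`. -/
def IsTraceClass (T : E →L[ℂ] E) : Prop :=
  ∀ (ι : Type u) (b : HilbertBasis ι ℂ E),
    Summable fun i => (⟪b i, CFC.sqrt (T.adjoint ∘L T) (b i)⟫_ℂ).re

end Operators

end BosonFock

end

open BosonFock

noncomputable section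

namespace BosonFock

open scoped Nat

/-! ### Summation over the fibres of a map -/

/-! Write `f z = exp(μ̄ᵀz + zᵀĀz)`. The parameters of `Z` say that its kernel on exponential vectors
is `c · conj (f u) · f v · exp(u†Λv)`. Positivity of `Z`, tested on `e(v)/f(v) - e(0)` for small
`v`, gives `Λ ≥ 0` (`HasE2Params.posSemidef`). The vectors `√c f(z) e(√Λ z)` then have exactly this
kernel as Gram matrix, so `e(z) ↦ √c f(z) e(√Λ z)` extends to a bounded `W` with `Z = W†W`
(`exists_adjoint_comp_self_of_gram`, `HasE2Params.exists_sqrt_factor`).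

The action of `W` on the particle basis is read off from Taylor coefficients. Since `e(z) = ∑ zᵗ/√t!
|t⟩`, the function `⟨r, W e(z)⟩` generates the numbers `⟨r, W t⟩`. It is also the product of `√c
f(z)`, whose coefficients are built from `φ`, and the polynomial `⟨r, e(√Λ z)⟩`. Uniqueness of
coefficients yields the prescribed formula (`apply_ket_of_apply_expVec`). Thus both prescriptions
for `Z₁` are restrictions of `W`, which gives existence, uniqueness and the closure at once.

The polar decomposition and the trace criterion follow from `‖W x‖² = ⟨x, Z x⟩ = ‖√Z x‖²`, and the
matrix elements for `μ = 0` from `⟨t, Z t'⟩ = ⟨W t, W t'⟩`. -/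

theorem hasSum_of_forall_eq {ι E : Type*} [AddCommMonoid E] [TopologicalSpace E]
    {f g : ι → E} {s : E} (h : ∀ x, f x = g x) (hg : HasSum g s) : HasSum f s :=
  funext h ▸ hg

/-- `S k` need only catch the nonzero terms of the fibre. This matters for `rowColSum`, which
ignores the entries below the diagonal and so can have infinite fibres. -/
theorem hasSum_sum_fiber {ι κ E : Type*} [NormedAddCommGroup E] {g : ι → E}
    {s : E} (hg : HasSum g s) (f : ι → κ) (S : κ → Finset ι)
    (hS : ∀ x, g x ≠ 0 → ∀ k, x ∈ S k ↔ f x = k) (hS' : ∀ k, ∀ x ∈ S k, f x = k) :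
    HasSum (fun k => ∑ x ∈ S k, g x) s := by
  have h1 : HasSum (g ∘ Equiv.sigmaFiberEquiv f) s := (Equiv.hasSum_iff _).2 hg
  refine h1.sigma fun k => ?_
  show HasSum (g ∘ ((↑) : {x // f x = k} → ι)) _
  rw [show (fun x => f x = k) = (· ∈ {x | f x = k}) from rfl]
  rw [show HasSum (g ∘ ((↑) : {x // x ∈ {x | f x = k}} → ι)) (∑ x ∈ S k, g x) ↔ _ from
    hasSum_subtype_iff_indicator]
  have h2 : ∑ x ∈ S k, g x = ∑ x ∈ S k, Set.indicator {x | f x = k} g x :=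
    Finset.sum_congr rfl fun x hx => 
      (Set.indicator_of_mem (show x ∈ {x | f x = k} from hS' k x hx) g).symm
  rw [h2]
  refine hasSum_sum_of_ne_finset_zero fun x hx => ?_
  by_cases h3 : f x = k
  · rw [Set.indicator_of_mem (show x ∈ {x | f x = k} from h3)]
    by_contra h
    exact hx ((hS x h k).2 h3)
  · exact Set.indicator_of_notMem (show x ∉ {x | f x = k} from h3) g

/-! ### The exponential series in several variables -/

/-- The multinomial theorem divided by `k!`. -/
theorem sum_piAntidiag_prod_pow_div_factorial {ι K : Type*} [Fintype ι] [DecidableEq ι]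
    [Field K] [CharZero K] (x : ι → K) (k : ℕ) :
    ∑ R ∈ Finset.piAntidiag Finset.univ k, ∏ i, (x i ^ R i / ((R i)! : K))
      = (∑ i, x i) ^ k / (k ! : K) := by
  rw [Finset.sum_pow_eq_sum_piAntidiag, Finset.sum_div]
  refine Finset.sum_congr rfl fun R hR => ?_
  have hk : ∑ i, R i = k := (Finset.mem_piAntidiag.1 hR).1
  have h1 := Nat.multinomial_spec Finset.univ R
  rw [hk] at h1
  have h2 : (∏ i, ((R i)! : K)) * (Nat.multinomial Finset.univ R : K) = (k ! : K) := by
    exact_mod_cast h1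
  have h3 : (∏ i, ((R i)! : K)) ≠ 0 :=
    Finset.prod_ne_zero_iff.2 fun i _ => Nat.cast_ne_zero.2 (Nat.factorial_ne_zero _)
  have h4 : (k ! : K) ≠ 0 := Nat.cast_ne_zero.2 (Nat.factorial_ne_zero _)
  rw [Finset.prod_div_distrib, div_eq_div_iff h3 h4, ← h2]
  ring

/-- The terms are nonnegative, so summability may be checked by grouping by total degree, where the
group sums form the series of `exp (∑ x i)`. -/
theorem summable_prod_pow_div_factorial {ι : Type*} [Fintype ι] {x : ι → ℝ}
    (hx : ∀ i, 0 ≤ x i) :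
    Summable fun R : ι → ℕ => ∏ i, (x i ^ R i / ((R i)! : ℝ)) := by
  classical
  have hnn : ∀ R : ι → ℕ, 0 ≤ ∏ i, (x i ^ R i / ((R i)! : ℝ)) := fun R =>
    Finset.prod_nonneg fun i _ => div_nonneg (pow_nonneg (hx i) _) (Nat.cast_nonneg _)
  rw [← (Equiv.sigmaFiberEquiv fun R : ι → ℕ => ∑ i, R i).summable_iff]
  refine (summable_sigma_of_nonneg fun _ => hnn _).2 ?_
  have h1 : ∀ k : ℕ, HasSum (fun R : {R : ι → ℕ // ∑ i, R i = k} =>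
      ∏ i, (x i ^ (R : ι → ℕ) i / (((R : ι → ℕ) i)! : ℝ))) ((∑ i, x i) ^ k / (k ! : ℝ)) := by
    intro k
    rw [← sum_piAntidiag_prod_pow_div_factorial]
    have hmem : ∀ R : ι → ℕ, R ∈ Finset.piAntidiag Finset.univ k ↔ ∑ i, R i = k := by
      intro R
      simp
    rw [← (Equiv.subtypeEquivRight hmem).hasSum_iff]
    exact Finset.hasSum (Finset.piAntidiag Finset.univ k)
      (fun R : ι → ℕ => ∏ i, (x i ^ R i / ((R i)! : ℝ)))
  refine ⟨fun k => (h1 k).summable, ?_⟩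
  convert Real.summable_pow_div_factorial (∑ i, x i) using 2 with k
  exact (h1 k).tsum_eq

theorem hasSum_exp_sum {ι : Type*} [Fintype ι] (x : ι → ℂ) :
    HasSum (fun R : ι → ℕ => ∏ i, (x i ^ R i / ((R i)! : ℂ))) (Complex.exp (∑ i, x i)) := by
  classical
  have h1 : Summable fun R : ι → ℕ => ∏ i, (x i ^ R i / ((R i)! : ℂ)) := by
    refine Summable.of_norm ?_
    convert summable_prod_pow_div_factorial (x := fun i => ‖x i‖) (fun i => norm_nonneg _)
      using 2 with R
    rw [norm_prod]
    refine Finset.prod_congr rfl fun i _ => ?_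
    rw [norm_div, norm_pow, Complex.norm_natCast]
  have h2 := hasSum_sum_fiber h1.hasSum (fun R => ∑ i, R i)
    (fun k => Finset.piAntidiag Finset.univ k) (fun R _ k => by simp) (fun k R hR => by
      simpa using hR)
  simp only [sum_piAntidiag_prod_pow_div_factorial] at h2
  have h3 : HasSum (fun k : ℕ => (∑ i, x i) ^ k / (k ! : ℂ)) (Complex.exp (∑ i, x i)) := by
    rw [Complex.exp_eq_exp_ℂ]
    exact NormedSpace.expSeries_div_hasSum_exp (∑ i, x i)
  rw [← h2.unique h3]
  exact h1.hasSum

/-! ### Entire power series in several variables -/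

/-- `F z = ∑ₜ aₜ zᵗ` for all `z`, with unconditional convergence. -/
def HasPowerSeries {n : ℕ} (a : MultiIndex n → ℂ) (F : (Fin n → ℂ) → ℂ) : Prop :=
  ∀ z, HasSum (fun t => a t * mpow z t) (F z)

/-- The finite set of multi-indices of degree `k`. -/
def degIndices (n k : ℕ) : Finset (MultiIndex n) := Finset.piAntidiag Finset.univ k

theorem mem_degIndices {n k : ℕ} {t : MultiIndex n} : t ∈ degIndices n k ↔ deg t = k := by
  simp [degIndices, deg]

/-- `F z = ∑ₖ ∑_{|t| = k} aₜ zᵗ` for all `z`. -/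
def HasHomogeneousSeries {n : ℕ} (a : MultiIndex n → ℂ) (F : (Fin n → ℂ) → ℂ) : Prop :=
  ∀ z, HasSum (fun k => ∑ t ∈ degIndices n k, a t * mpow z t) (F z)

/-- Grouping by degree asks for less convergence. It is the form in which `⟨ψ, e(z)⟩` arises from
the orthogonal sum over particle numbers, and it still determines the coefficients. -/
theorem HasPowerSeries.hasHomogeneousSeries {n : ℕ} {a : MultiIndex n → ℂ}
    {F : (Fin n → ℂ) → ℂ} (h : HasPowerSeries a F) : HasHomogeneousSeries a F := fun z =>
  hasSum_sum_fiber (h z) deg (degIndices n) (fun _ _ _ => mem_degIndices)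
    (fun _ _ => mem_degIndices.1)

theorem mpow_smul {n : ℕ} (c : ℂ) (z : Fin n → ℂ) (t : MultiIndex n) :
    mpow (c • z) t = c ^ deg t * mpow z t := by
  simp [mpow, deg, mul_pow, Finset.prod_mul_distrib, Finset.prod_pow_eq_pow_sum]

theorem mpow_add {n : ℕ} (z : Fin n → ℂ) (s t : MultiIndex n) :
    mpow z (s + t) = mpow z s * mpow z t := by
  simp [mpow, pow_add, Finset.prod_mul_distrib]

theorem eq_zero_of_hasSum_pow_smul_eq_zero {a : ℕ → ℂ}
    (h : ∀ z : ℂ, HasSum (fun k => z ^ k * a k) 0) (k : ℕ) : a k = 0 := by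
  have h1 : HasFPowerSeriesAt (0 : ℂ → ℂ) (FormalMultilinearSeries.ofScalars ℂ a) 0 := by
    rw [hasFPowerSeriesAt_iff]
    refine Filter.Eventually.of_forall fun z => ?_
    simpa using h z
  rw [← FormalMultilinearSeries.coeff_ofScalars (p := a) (n := k), h1.eq_zero]
  rfl

theorem eq_zero_of_forall_sum_mpow_eq_zero {n : ℕ} {a : MultiIndex n → ℂ}
    {S : Finset (MultiIndex n)} (h : ∀ z, ∑ t ∈ S, a t * mpow z t = 0)
    {t : MultiIndex n} (ht : t ∈ S) : a t = 0 := by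
  classical
  let P : MvPolynomial (Fin n) ℂ :=
    ∑ t ∈ S, MvPolynomial.monomial (Finsupp.equivFunOnFinite.symm t) (a t)
  have hP : P = 0 := by
    refine MvPolynomial.funext fun z => ?_
    rw [map_zero, ← h z]
    simp only [P, map_sum]
    refine Finset.sum_congr rfl fun t _ => ?_
    rw [MvPolynomial.eval_monomial, Finsupp.prod_fintype _ _ (by simp)]
    rfl
  have h2 := congrArg (MvPolynomial.coeff (Finsupp.equivFunOnFinite.symm t)) hP
  simpa [P, MvPolynomial.coeff_sum, MvPolynomial.coeff_monomial, ht] using h2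

/-- On each complex line `z • w` the series is a one-variable power series whose `k`-th coefficient
is the homogeneous part of degree `k` at `w`. Each part therefore vanishes as a function of `w`,
hence as a polynomial. -/
theorem HasHomogeneousSeries.eq_zero {n : ℕ} {a : MultiIndex n → ℂ}
    (h : HasHomogeneousSeries a 0) : a = 0 := by
  funext t
  refine eq_zero_of_forall_sum_mpow_eq_zero (S := degIndices n (deg t)) (fun w => ?_)
    (mem_degIndices.2 rfl)
  refine eq_zero_of_hasSum_pow_smul_eq_zero
    (a := fun k => ∑ t ∈ degIndices n k, a t * mpow w t) (fun z => ?_) (deg t)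
  refine hasSum_of_forall_eq (fun k => ?_) (h (z • w))
  rw [Finset.mul_sum]
  refine Finset.sum_congr rfl fun s hs => ?_
  rw [mpow_smul, mem_degIndices.1 hs]
  ring

theorem HasHomogeneousSeries.unique {n : ℕ} {a b : MultiIndex n → ℂ}
    {F : (Fin n → ℂ) → ℂ} (ha : HasHomogeneousSeries a F) (hb : HasHomogeneousSeries b F) :
    a = b := by
  rw [← sub_eq_zero]
  refine HasHomogeneousSeries.eq_zero fun z => ?_
  have h := (ha z).sub (hb z)
  rw [sub_self] at h
  refine hasSum_of_forall_eq (fun k => ?_) h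
  rw [← Finset.sum_sub_distrib]
  exact Finset.sum_congr rfl fun t _ => sub_mul _ _ _

/-- The Cauchy product: both series converge absolutely, so the double sum can be grouped by `s + r
= t`. -/
theorem HasPowerSeries.mul {n : ℕ} {a b : MultiIndex n → ℂ} {F G : (Fin n → ℂ) → ℂ}
    (ha : HasPowerSeries a F) (hb : HasPowerSeries b G) :
    HasPowerSeries (fun t => ∑ s ∈ Finset.Iic t, a s * b (t - s)) (fun z => F z * G z) := by
  classical
  intro z
  have h0 : Summable fun p : MultiIndex n × MultiIndex n =>
      (a p.1 * mpow z p.1) * (b p.2 * mpow z p.2) :=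
    summable_mul_of_summable_norm (f := fun t => a t * mpow z t)
      (g := fun t => b t * mpow z t) (ha z).summable.norm (hb z).summable.norm
  have h1 := (ha z).mul (hb z) h0
  have h2 := hasSum_sum_fiber h1 (fun p : MultiIndex n × MultiIndex n => p.1 + p.2)
    (fun t => (Finset.Iic t).image fun s => (s, t - s)) ?_ ?_
  · refine hasSum_of_forall_eq (fun t => ?_) h2
    rw [Finset.sum_image (fun x _ y _ h => (Prod.ext_iff.1 h).1), Finset.sum_mul]
    refine Finset.sum_congr rfl fun s hs => ?_
    have h3 : s + (t - s) = t := add_tsub_cancel_of_le (Finset.mem_Iic.1 hs)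
    rw [← congrArg (mpow z) h3, mpow_add]
    ring
  · rintro ⟨s, r⟩ - t
    simp only [Finset.mem_image, Finset.mem_Iic, Prod.mk.injEq]
    constructor
    · rintro ⟨s, hs, rfl, rfl⟩
      exact add_tsub_cancel_of_le hs
    · rintro rfl
      exact ⟨s, le_self_add, rfl, add_tsub_cancel_left _ _⟩
  · intro t p hp
    obtain ⟨s, hs, rfl⟩ := Finset.mem_image.1 hp
    exact add_tsub_cancel_of_le (Finset.mem_Iic.1 hs)

theorem hasPowerSeries_exp_dotProduct {n : ℕ} (μ : Fin n → ℂ) :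
    HasPowerSeries (fun t => mpow μ t / (mfact t : ℂ)) (fun z => Complex.exp (μ ⬝ᵥ z)) := by
  intro z
  refine hasSum_of_forall_eq (fun t => ?_) (hasSum_exp_sum fun i => μ i * z i)
  simp only [mpow, mfact, Nat.cast_prod, mul_pow, Finset.prod_div_distrib,
    Finset.prod_mul_distrib]
  ring

theorem rowColSum_eq_of_isUpper {n : ℕ} {R : Matrix (Fin n) (Fin n) ℕ} (hR : IsUpper R)
    (i : Fin n) : rowColSum R i = ∑ j, R j i + ∑ j, R i j := by
  unfold rowColSum
  congr 1
  · refine Finset.sum_subset (Finset.subset_univ _) fun j _ hj => hR j i ?_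
    simpa using hj
  · refine Finset.sum_subset (Finset.subset_univ _) fun j _ hj => hR i j ?_
    simpa using hj

theorem sum_sub_trace {n : ℕ} (R : Matrix (Fin n) (Fin n) ℕ) :
    (∑ i, ∑ j, R i j) - R.trace = ∑ i, ∑ j, if i = j then 0 else R i j := by
  have h : ∑ i, ∑ j, R i j = R.trace + ∑ i, ∑ j, if i = j then 0 else R i j := by
    rw [Matrix.trace, ← Finset.sum_add_distrib]
    refine Finset.sum_congr rfl fun i _ => ?_
    have : R.diag i = ∑ j, if i = j then R i j else 0 := by simp
    rw [this, ← Finset.sum_add_distrib]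
    refine Finset.sum_congr rfl fun j _ => ?_
    split_ifs <;> simp
  rw [h, Nat.add_sub_cancel_left]

/-- Symmetry folds the entries below the diagonal onto those above. The resulting factor 2 off the
diagonal is the source of the power of 2 in `phi`. -/
theorem dotProduct_mulVec_eq_sum_upper {n : ℕ} {B : Matrix (Fin n) (Fin n) ℂ}
    (hB : B.IsSymm) (z : Fin n → ℂ) :
    z ⬝ᵥ (B *ᵥ z) = ∑ i, ∑ j, if j < i then 0 else
      (if i = j then 1 else 2) * B i j * (z i * z j) := by
  have h1 : z ⬝ᵥ (B *ᵥ z) = ∑ i, ∑ j, B i j * (z i * z j) := by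
    simp only [dotProduct, Matrix.mulVec, Finset.mul_sum]
    exact Finset.sum_congr rfl fun i _ => Finset.sum_congr rfl fun j _ => by ring
  have h2 : ∀ i j, B i j * (z i * z j) = (if j < i then B i j * (z i * z j) else 0)
      + (if j < i then 0 else B i j * (z i * z j)) := fun i j => by split_ifs <;> simp
  rw [h1, Finset.sum_congr rfl fun i _ => Finset.sum_congr rfl fun j _ => h2 i j]
  simp_rw [Finset.sum_add_distrib]
  rw [Finset.sum_comm (f := fun i j => if j < i then B i j * (z i * z j) else 0)]
  simp_rw [← Finset.sum_add_distrib]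
  refine Finset.sum_congr rfl fun i _ => Finset.sum_congr rfl fun j _ => ?_
  rcases lt_trichotomy i j with h | h | h
  · rw [if_pos h, if_neg h.not_gt, if_neg h.not_gt, if_neg h.ne, hB.apply i j]
    ring
  · subst h
    simp
  · rw [if_neg h.not_gt, if_pos h, if_pos h, add_zero]

/-- Expanding the exponential of the folded quadratic form gives a sum over exponent matrices `R`.
The monomial of `R` is `z ^ rowColSum R`, so collecting equal monomials produces the sum over
`Δ(t)`. -/
theorem hasPowerSeries_exp_quadratic {n : ℕ} {B : Matrix (Fin n) (Fin n) ℂ}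
    (hB : B.IsSymm) :
    HasPowerSeries (fun t => phi B t / (√(mfact t : ℝ) : ℂ))
      (fun z => Complex.exp (z ⬝ᵥ (B *ᵥ z))) := by
  intro z
  let x : Fin n × Fin n → ℂ := fun p => if p.2 < p.1 then 0 else
      (if p.1 = p.2 then 1 else 2) * B p.1 p.2 * (z p.1 * z p.2)
  have h1 : HasSum (fun R : Matrix (Fin n) (Fin n) ℕ =>
      ∏ i, ∏ j, (x (i, j) ^ R i j / ((R i j)! : ℂ))) (Complex.exp (z ⬝ᵥ (B *ᵥ z))) := by
    rw [dotProduct_mulVec_eq_sum_upper hB, ← Fintype.sum_prod_type' (f := fun i j => x (i, j))]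
    rw [← ((Equiv.curry (Fin n) (Fin n) ℕ).trans Matrix.of).hasSum_iff]
    convert hasSum_exp_sum x using 2 with R
    rw [Fintype.prod_prod_type]
    rfl
  have hterm : ∀ R : Matrix (Fin n) (Fin n) ℕ, IsUpper R →
      ∏ i, ∏ j, (x (i, j) ^ R i j / ((R i j)! : ℂ)) =
      ((2 : ℂ) ^ ((∑ i, ∑ j, R i j) - R.trace) * (∏ i, ∏ j, B i j ^ R i j) /
      ((∏ i, ∏ j, (R i j)! : ℕ) : ℂ)) * mpow z (rowColSum R) := by
    intro R hR
    have hx : ∀ i j, x (i, j) ^ R i j = 2 ^ (if i = j then 0 else R i j) * B i j ^ R i j *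
        (z i ^ R i j * z j ^ R i j) := by
      intro i j
      by_cases hji : j < i
      · rw [hR i j hji]
        simp
      · by_cases hij : i = j
        · subst hij
          simp [x, mul_pow]
        · simp [x, hji, hij, mul_pow]
    have hz : mpow z (rowColSum R) = (∏ i, ∏ j, z i ^ R i j) * ∏ i, ∏ j, z j ^ R i j := by
      rw [Finset.prod_comm (f := fun i j => z j ^ R i j), ← Finset.prod_mul_distrib]
      refine Finset.prod_congr rfl fun i _ => ?_
      rw [rowColSum_eq_of_isUpper hR, pow_add, Finset.prod_pow_eq_pow_sum,
        Finset.prod_pow_eq_pow_sum, mul_comm]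
    rw [hz, sum_sub_trace]
    simp only [hx, Finset.prod_div_distrib, Finset.prod_mul_distrib, Finset.prod_pow_eq_pow_sum,
      Nat.cast_prod]
    ring
  have h2 := hasSum_sum_fiber h1 rowColSum upperIndices ?_ ?_
  · refine hasSum_of_forall_eq (fun t => ?_) h2
    have h3 : (√(mfact t : ℝ) : ℂ) ≠ 0 := by simpa using ketCoeff_ne_zero 0 t
    show phi B t / (√(mfact t : ℝ) : ℂ) * mpow z t = _
    rw [phi, mul_div_cancel_left₀ _ h3, Finset.sum_mul]
    refine Finset.sum_congr rfl fun R hR => ?_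
    obtain ⟨hR1, hR2⟩ := (mem_upperIndices t R).1 hR
    rw [hterm R hR1, hR2]
  -- A nonzero term has exponent 0 wherever `x` vanishes, that is below the diagonal; so only upper
  -- triangular `R` contribute.
  · intro R hR t
    rw [mem_upperIndices, and_iff_right_iff_imp]
    intro _ i j hji
    have := Finset.prod_ne_zero_iff.1 (Finset.prod_ne_zero_iff.1 hR i (Finset.mem_univ _)) j
      (Finset.mem_univ _)
    by_contra h
    exact this (by simp [x, hji, h])
  · intro t R hR
    exact ((mem_upperIndices t R).1 hR).2

/-! ### Bounded operators with a prescribed Gram kernel, and polar decomposition -/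

section Operators

universe u

variable {E : Type u} [NormedAddCommGroup E] [InnerProductSpace ℂ E]

theorem eq_of_forall_inner_eq {ι : Type*} {x : ι → E}
    (hx : Dense (Submodule.span ℂ (Set.range x) : Set E)) {v w : E}
    (h : ∀ i, ⟪x i, v⟫_ℂ = ⟪x i, w⟫_ℂ) : v = w := by
  refine hx.eq_of_inner_right ℂ fun y hy => ?_
  induction hy using Submodule.span_induction with
  | mem y hy =>
    obtain ⟨i, rfl⟩ := hy
    exact h i
  | zero => simp
  | add a b _ _ ha hb => rw [inner_add_left, inner_add_left, ha, hb]
  | smul c a _ ha => rw [inner_smul_left, inner_smul_left, ha]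

/-- The graph of the bounded `W` is closed and contains that of `T`; density of the domain makes the
latter dense in it. -/
theorem isClosable_and_closure_eq_toPMap {T : E →ₗ.[ℂ] E} {W : E →L[ℂ] E}
    (hT : Dense (T.domain : Set E)) (h : ∀ x : T.domain, T x = W x) :
    T.IsClosable ∧ T.closure = W.toLinearMap.toPMap ⊤ := by
  have hmem : ∀ p : E × E, p ∈ (W.toLinearMap.toPMap ⊤).graph ↔ W p.1 = p.2 := by
    intro p
    rw [LinearPMap.mem_graph_iff]
    constructor
    · rintro ⟨y, hy, hp⟩
      rw [← hy, ← hp]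
      rfl
    · intro hp
      exact ⟨⟨p.1, Submodule.mem_top⟩, rfl, hp⟩
  have hgraph : T.graph.topologicalClosure = (W.toLinearMap.toPMap ⊤).graph := by
    refine le_antisymm (Submodule.topologicalClosure_minimal _ ?_ ?_) ?_
    · intro p hp
      obtain ⟨y, hy, hp⟩ := (LinearPMap.mem_graph_iff T).1 hp
      rw [hmem, ← hy, ← hp, h]
    · have : ((W.toLinearMap.toPMap ⊤).graph : Set (E × E)) = {p | W p.1 = p.2} :=
        Set.ext hmem
      rw [this]
      exact isClosed_eq (by fun_prop) (by fun_prop)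
    · rintro ⟨x, y⟩ hp
      obtain rfl : W x = y := (hmem _).1 hp
      have hx : x ∈ closure (T.domain : Set E) := hT x
      have hc : Continuous fun x => (x, W x) := by fun_prop
      refine map_mem_closure (f := fun x : E => (x, W x)) hc hx fun z hz => ?_
      have h1 := T.mem_graph ⟨z, hz⟩
      rw [h ⟨z, hz⟩] at h1
      exact h1
  have hcl : T.IsClosable := ⟨_, hgraph⟩
  exact ⟨hcl, LinearPMap.eq_of_eq_graph (by rw [← hcl.graph_closure_eq_closure_graph, hgraph])⟩

variable [CompleteSpace E]

/-- On formal linear combinations the Gram identity gives `‖Y a‖² = ⟨X a, Z (X a)⟩ ≤ ‖Z‖ ‖X a‖²`.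
Hence `Y` factors through `X` with a bounded factor, and no linear independence of the `x i` is
required. -/
theorem exists_adjoint_comp_self_of_gram {ι : Type*} {x y : ι → E} (Z : E →L[ℂ] E)
    (hx : Dense (Submodule.span ℂ (Set.range x) : Set E))
    (h : ∀ i j, ⟪y i, y j⟫_ℂ = ⟪x i, Z (x j)⟫_ℂ) :
    ∃ W : E →L[ℂ] E, (∀ i, W (x i) = y i) ∧ Z = W.adjoint ∘L W := by
  let X := Finsupp.linearCombination ℂ x
  let Y := Finsupp.linearCombination ℂ y
  have hgram : ∀ a b, ⟪Y a, Y b⟫_ℂ = ⟪X a, Z (X b)⟫_ℂ := by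
    intro a b
    simp only [X, Y, Finsupp.linearCombination_apply, Finsupp.sum, map_sum, map_smul, sum_inner,
      inner_sum, inner_smul_left, inner_smul_right, h]
  have hbound : ∀ a, ‖Y a‖ ≤ √‖Z‖ * ‖X a‖ := by
    intro a
    refine le_of_sq_le_sq ?_ (by positivity)
    rw [mul_pow, Real.sq_sqrt (norm_nonneg _)]
    have h1 : (‖Y a‖ : ℂ) ^ 2 = ⟪X a, Z (X a)⟫_ℂ := by
      rw [← hgram, inner_self_eq_norm_sq_to_K]
      rfl
    have h2 : ‖Y a‖ ^ 2 = ‖⟪X a, Z (X a)⟫_ℂ‖ := by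
      rw [← h1, norm_pow, Complex.norm_real, norm_norm]
    rw [h2]
    calc ‖⟪X a, Z (X a)⟫_ℂ‖ ≤ ‖X a‖ * ‖Z (X a)‖ := norm_inner_le_norm _ _
      _ ≤ ‖X a‖ * (‖Z‖ * ‖X a‖) := by gcongr; exact Z.le_opNorm _
      _ = ‖Z‖ * ‖X a‖ ^ 2 := by ring
  have hdense : DenseRange X := by
    rw [DenseRange, ← LinearMap.coe_range, Finsupp.range_linearCombination]
    exact hx
  have hW : ∀ i, Y.extendOfNorm X (x i) = y i := by
    intro i
    have := LinearMap.extendOfNorm_eq hdense ⟨_, hbound⟩ (Finsupp.single i 1)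
    simpa [X, Y] using this
  refine ⟨Y.extendOfNorm X, hW, ContinuousLinearMap.ext_on hx ?_⟩
  rintro _ ⟨j, rfl⟩
  refine eq_of_forall_inner_eq hx fun i => ?_
  rw [ContinuousLinearMap.comp_apply, ContinuousLinearMap.adjoint_inner_right, hW, hW, h]

/-- The map `S x ↦ W x` is well defined and isometric on the range of `S`. It extends to the closure
`K`, and `V` is this extension after the orthogonal projection onto `K`. -/
theorem exists_partialIsometry_of_norm_eq {S W : E →L[ℂ] E} (h : ∀ x, ‖W x‖ = ‖S x‖) :
    ∃ V : E →L[ℂ] E, IsPartialIsometry V ∧ W = V ∘L S := by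
  let K : Submodule ℂ E := (LinearMap.range S.toLinearMap).topologicalClosure
  have hK : IsClosed (K : Set E) := Submodule.isClosed_topologicalClosure _
  have : CompleteSpace K := hK.completeSpace_coe
  have hmem : ∀ x, S x ∈ K := fun x =>
    Submodule.le_topologicalClosure _ (LinearMap.mem_range_self S.toLinearMap x)
  let S' : E →ₗ[ℂ] K := S.toLinearMap.codRestrict K hmem
  have hdense : DenseRange S' := by
    rw [DenseRange, Subtype.dense_iff]
    intro x hx
    have h1 : (Subtype.val '' Set.range S' : Set E) = LinearMap.range S.toLinearMap := by
      rw [← Set.range_comp]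
      rfl
    have h2 : x ∈ closure (LinearMap.range S.toLinearMap : Set E) := hx
    rw [← h1] at h2
    exact h2
  have hbound : ∀ x, ‖W.toLinearMap x‖ ≤ 1 * ‖S' x‖ := fun x => by
    rw [one_mul]
    exact (h x).le
  let U : K →L[ℂ] E := W.toLinearMap.extendOfNorm S'
  have hU : ∀ x, U (S' x) = W x := LinearMap.extendOfNorm_eq hdense ⟨1, hbound⟩
  have hiso : ∀ y, ‖U y‖ = ‖y‖ := by
    intro y
    refine hdense.induction_on (p := fun y => ‖U y‖ = ‖y‖) y
      (isClosed_eq (by fun_prop) (by fun_prop)) fun x => ?_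
    rw [hU]
    exact h x
  refine ⟨U ∘L K.orthogonalProjectionOnto, ?_, ?_⟩
  · intro x hx
    -- The kernel of `V` contains `Kᗮ`, so its orthogonal complement lies in `K`, where `V` is
    -- isometric.
    have h1 : Kᗮ ≤ LinearMap.ker (U ∘L K.orthogonalProjectionOnto).toLinearMap := by
      intro y hy
      rw [LinearMap.mem_ker]
      show U (K.orthogonalProjectionOnto y) = 0
      rw [Submodule.orthogonalProjectionOnto_eq_zero_iff.2 hy, map_zero]
    have h2 : x ∈ K := by
      have h3 := Submodule.orthogonal_le h1 hx
      rwa [Submodule.orthogonal_orthogonal] at h3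
    show ‖U (K.orthogonalProjectionOnto x)‖ = ‖x‖
    rw [hiso, K.orthogonalProjectionOnto_mem_subspace_eq_self ⟨x, h2⟩]
    rfl
  · ext x
    show W x = U (K.orthogonalProjectionOnto (S' x : E))
    rw [Submodule.orthogonalProjectionOnto_mem_subspace_eq_self, hU]

theorem exists_partialIsometry_comp_sqrt {Z W : E →L[ℂ] E} (hZ : Z.IsPositive)
    (h : Z = W.adjoint ∘L W) : ∃ V : E →L[ℂ] E, IsPartialIsometry V ∧ W = V ∘L CFC.sqrt Z := by
  refine exists_partialIsometry_of_norm_eq fun x => ?_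
  have hZ' : 0 ≤ Z := (ContinuousLinearMap.nonneg_iff_isPositive Z).2 hZ
  have h1 : CFC.sqrt Z * CFC.sqrt Z = Z := CFC.sqrt_mul_sqrt_self Z hZ'
  have h2 : (CFC.sqrt Z).adjoint = CFC.sqrt Z := (CFC.sqrt_nonneg Z).isSelfAdjoint
  have h3 : ⟪W x, W x⟫_ℂ = ⟪CFC.sqrt Z x, CFC.sqrt Z x⟫_ℂ := by
    rw [← ContinuousLinearMap.adjoint_inner_right W, ← ContinuousLinearMap.comp_apply, ← h,
      ← ContinuousLinearMap.adjoint_inner_right (CFC.sqrt Z), h2,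
      ← mul_apply_eq_comp, h1]
  rw [inner_self_eq_norm_sq_to_K, inner_self_eq_norm_sq_to_K] at h3
  have h4 : ‖W x‖ ^ 2 = ‖CFC.sqrt Z x‖ ^ 2 := by exact_mod_cast h3
  exact (sq_eq_sq₀ (norm_nonneg _) (norm_nonneg _)).1 h4

/-- Here `|Z| = Z` and `⟨b, Z b⟩ = ‖W b‖²`, so the two series agree term by term in every
orthonormal basis. -/
theorem isTraceClass_iff_isHilbertSchmidt {Z W : E →L[ℂ] E} (hZ : Z.IsPositive)
    (h : Z = W.adjoint ∘L W) : IsTraceClass Z ↔ IsHilbertSchmidt W := by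
  have hZ' : 0 ≤ Z := (ContinuousLinearMap.nonneg_iff_isPositive Z).2 hZ
  have h1 : CFC.sqrt (Z.adjoint ∘L Z) = Z := by
    have : Z.adjoint ∘L Z = Z * Z := by
      rw [show Z.adjoint = Z from hZ'.isSelfAdjoint]
      rfl
    rw [this, CFC.sqrt_mul_self Z hZ']
  have h2 : ∀ x, (⟪x, Z x⟫_ℂ).re = ‖W x‖ ^ 2 := by
    intro x
    rw [h, ContinuousLinearMap.comp_apply, ContinuousLinearMap.adjoint_inner_right,
      inner_self_eq_norm_sq_to_K]
    norm_cast
  unfold IsTraceClass IsHilbertSchmidt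
  simp only [h1, h2]

end Operators

/-! ### Inner products in the Fock space -/

/-- The inner product of the Hilbert space of symmetric tensors; the shortcut keeps instance
search from taking the `CStarModule` structure. -/
instance (n k : ℕ) : Inner ℂ (symTensor n k) := InnerProductSpace.toInner

theorem hasSum_inner_comp {n : ℕ} (ψ χ : Fock n) :
    HasSum (fun k => ⟪comp k ψ, comp k χ⟫_ℂ) ⟪ψ, χ⟫_ℂ :=
  lp.hasSum_inner (𝕜 := ℂ) (G := fun k : ℕ => symTensor n k) ψ χ

theorem inner_incl_left {n k : ℕ} (w : symTensor n k) (χ : Fock n) :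
    ⟪incl k w, χ⟫_ℂ = ⟪w, comp k χ⟫_ℂ := by
  refine (hasSum_inner_comp (incl k w) χ).unique ?_
  convert hasSum_single (f := fun m => ⟪comp m (incl k w), comp m χ⟫_ℂ) k ?_ using 1
  · rw [comp_incl_self]
  · intro m hm
    rw [comp_incl_ne w hm, inner_zero_left]

theorem inner_symTensor {n k : ℕ} (x y : symTensor n k) :
    ⟪x, y⟫_ℂ = ∑ i, (starRingEnd ℂ) ((x : EuclideanSpace ℂ (Fin k → Fin n)) i) *
      (y : EuclideanSpace ℂ (Fin k → Fin n)) i := by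
  rw [Submodule.coe_inner, PiLp.inner_apply]
  exact Finset.sum_congr rfl fun i _ => mul_comm _ _

theorem inner_symTensor_smul_left {n k : ℕ} (c : ℂ) (x y : symTensor n k) :
    ⟪c • x, y⟫_ℂ = (starRingEnd ℂ) c * ⟪x, y⟫_ℂ :=
  inner_smul_left x y c

theorem inner_symTensor_smul_right {n k : ℕ} (c : ℂ) (x y : symTensor n k) :
    ⟪x, c • y⟫_ℂ = c * ⟪x, y⟫_ℂ :=
  inner_smul_right x y c

theorem inner_vecPow {n : ℕ} (u v : Fin n → ℂ) (k : ℕ) :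
    ⟪vecPow u k, vecPow v k⟫_ℂ = (star u ⬝ᵥ v) ^ k := by
  rw [inner_symTensor]
  have h2 := Finset.prod_univ_sum (fun _ : Fin k => (Finset.univ : Finset (Fin n)))
    (fun _ r => star u r * v r)
  simp only [Finset.prod_const, Finset.card_univ, Fintype.card_fin,
    Fintype.piFinset_univ] at h2
  rw [dotProduct, h2]
  refine Finset.sum_congr rfl fun i _ => ?_
  show (starRingEnd ℂ) (∏ l, u (i l)) * ∏ l, v (i l) = _
  rw [map_prod, ← Finset.prod_mul_distrib]
  rfl

theorem comp_expVec {n : ℕ} (z : Fin n → ℂ) (k : ℕ) :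
    comp k (expVec z) = ((√(k ! : ℝ) : ℂ)⁻¹) • vecPow z k := rfl

theorem ofReal_sqrt_mul_self {x : ℝ} (hx : 0 ≤ x) : (√x : ℂ) * (√x : ℂ) = (x : ℂ) := by
  rw [← Complex.ofReal_mul, Real.mul_self_sqrt hx]

theorem inner_expVec {n : ℕ} (u v : Fin n → ℂ) :
    ⟪expVec u, expVec v⟫_ℂ = Complex.exp (star u ⬝ᵥ v) := by
  refine (hasSum_inner_comp _ _).unique ?_
  rw [Complex.exp_eq_exp_ℂ]
  refine hasSum_of_forall_eq (fun k => ?_) (NormedSpace.expSeries_div_hasSum_exp (star u ⬝ᵥ v))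
  rw [comp_expVec, comp_expVec, inner_symTensor_smul_left, inner_symTensor_smul_right, inner_vecPow, map_inv₀,
    Complex.conj_ofReal, ← mul_assoc, ← mul_inv, ofReal_sqrt_mul_self (Nat.cast_nonneg _)]
  simp only [Complex.ofReal_natCast]
  ring

theorem genFun_eq_inner {n : ℕ} (Z : Fock n →L[ℂ] Fock n) (u v : Fin n → ℂ) :
    genFun Z (star u) v = ⟪expVec u, Z (expVec v)⟫_ℂ := by
  rw [genFun, star_star]

/-! ### Expansion of the exponential vectors in the particle basis -/

theorem sqrt_mfact_ne_zero {n : ℕ} (t : MultiIndex n) : (√(mfact t : ℝ) : ℂ) ≠ 0 := by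
  simpa using ketCoeff_ne_zero 0 t

theorem prod_comp_eq_mpow_occ {n k : ℕ} (z : Fin n → ℂ) (i : Fin k → Fin n) :
    ∏ l, z (i l) = mpow z (occ i) := by
  rw [mpow, ← Finset.prod_fiberwise_of_maps_to (g := i) (t := Finset.univ)
    (fun _ _ => Finset.mem_univ _)]
  refine Finset.prod_congr rfl fun r _ => ?_
  rw [Finset.prod_congr rfl (fun l hl => by rw [(Finset.mem_filter.1 hl).2]), Finset.prod_const]
  rfl

/-- At a sequence `i` only `t = occ i` contributes, and its normalization `√(t!/k!)` turns `1/√t!`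
into the factor `1/√k!` of the exponential vector. -/
theorem comp_expVec_eq_sum_ketSym {n : ℕ} (z : Fin n → ℂ) (k : ℕ) :
    comp k (expVec z)
      = ∑ t ∈ degIndices n k, (mpow z t / (√(mfact t : ℝ) : ℂ)) • ketSym k t := by
  rw [comp_expVec]
  ext i
  simp only [Submodule.coe_sum, WithLp.ofLp_sum, Finset.sum_apply]
  have hterm : ∀ (c : ℂ) (t : MultiIndex n), ((c • ketSym k t : symTensor n k) :
      EuclideanSpace ℂ (Fin k → Fin n)) i
      = c * (if occ i = t then (√((mfact t : ℝ) / (k ! : ℝ)) : ℂ) else 0) := fun _ _ => rfl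
  rw [Finset.sum_eq_single (occ i)]
  · rw [hterm, if_pos rfl]
    show (√(k ! : ℝ) : ℂ)⁻¹ * ∏ l, z (i l) = _
    rw [prod_comp_eq_mpow_occ, Real.sqrt_div (Nat.cast_nonneg _), Complex.ofReal_div]
    have := sqrt_mfact_ne_zero (occ i)
    field_simp
  · intro t _ ht
    rw [hterm, if_neg (fun h => ht h.symm), mul_zero]
  · intro h
    exact absurd (mem_degIndices.2 (deg_occ i)) h

theorem inner_ket_right {n : ℕ} (t : MultiIndex n) (χ : Fock n) :
    ⟪χ, ket t⟫_ℂ = ⟪comp (deg t) χ, ketSym (deg t) t⟫_ℂ := by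
  rw [← inner_conj_symm, ket, inner_incl_left, inner_conj_symm]

/-- This makes `z ↦ ⟨ψ, e(z)⟩` a generating function for the particle coefficients of `ψ`. -/
theorem hasHomogeneousSeries_inner_expVec {n : ℕ} (ψ : Fock n) :
    HasHomogeneousSeries (fun t => ⟪ψ, ket t⟫_ℂ / (√(mfact t : ℝ) : ℂ))
      (fun z => ⟪ψ, expVec z⟫_ℂ) := by
  intro z
  refine hasSum_of_forall_eq (fun k => ?_) (hasSum_inner_comp ψ (expVec z))
  rw [comp_expVec_eq_sum_ketSym, inner_sum]
  refine Finset.sum_congr rfl fun t ht => ?_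
  obtain rfl := mem_degIndices.1 ht
  simp only [inner_ket_right, inner_symTensor_smul_right]
  ring

theorem dense_span_of_forall_inner {E ι : Type*} [NormedAddCommGroup E] [InnerProductSpace ℂ E]
    [CompleteSpace E] {x : ι → E} (h : ∀ ψ : E, (∀ i, ⟪ψ, x i⟫_ℂ = 0) → ψ = 0) :
    Dense (Submodule.span ℂ (Set.range x) : Set E) := by
  rw [Submodule.dense_iff_topologicalClosure_eq_top, Submodule.topologicalClosure_eq_top_iff,
    Submodule.eq_bot_iff]
  exact fun ψ hψ => h ψ fun i =>
    (Submodule.mem_orthogonal' _ _).1 hψ _ (Submodule.subset_span ⟨i, rfl⟩)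

theorem eq_zero_of_forall_inner_ket_eq_zero {n : ℕ} {ψ : Fock n}
    (h : ∀ t, ⟪ψ, ket t⟫_ℂ = 0) : ψ = 0 := by
  refine Fock.ext fun k => ?_
  rw [map_zero, ← inner_self_eq_zero (𝕜 := ℂ), ← inner_incl_left]
  have h1 : ∀ χ ∈ Submodule.span ℂ (Set.range (ket (n := n))), ⟪χ, ψ⟫_ℂ = 0 := by
    intro χ hχ
    induction hχ using Submodule.span_induction with
    | mem y hy =>
      obtain ⟨t, rfl⟩ := hy
      rw [← inner_conj_symm, h, map_zero]
    | zero => simp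
    | add a b _ _ ha hb => rw [inner_add_left, ha, hb, add_zero]
    | smul c a _ ha => rw [inner_smul_left, ha, mul_zero]
  exact h1 _ (incl_mem_span_ket _ _)

theorem dense_span_ket (n : ℕ) :
    Dense (Submodule.span ℂ (Set.range (ket (n := n))) : Set (Fock n)) :=
  dense_span_of_forall_inner fun _ h => eq_zero_of_forall_inner_ket_eq_zero h

/-- A vector orthogonal to every `e(z)` has zero generating function, hence zero particle
coefficients. -/
theorem dense_span_expVec (n : ℕ) :
    Dense (Submodule.span ℂ (Set.range (expVec (n := n))) : Set (Fock n)) := by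
  refine dense_span_of_forall_inner fun ψ h => eq_zero_of_forall_inner_ket_eq_zero fun t => ?_
  have h1 := hasHomogeneousSeries_inner_expVec ψ
  simp only [h] at h1
  have h2 := congrFun h1.eq_zero t
  exact (div_eq_zero_iff.1 h2).resolve_right (sqrt_mfact_ne_zero t)

/-! ### Second quantization -/

theorem symPow_apply {n k : ℕ} (B : Matrix (Fin n) (Fin n) ℂ) (w : symTensor n k)
    (i : Fin k → Fin n) : (symPow B k w : EuclideanSpace ℂ (Fin k → Fin n)) i
      = ∑ j, (∏ l, B (i l) (j l)) * (w : EuclideanSpace ℂ (Fin k → Fin n)) j := rfl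

theorem symPow_vecPow {n : ℕ} (B : Matrix (Fin n) (Fin n) ℂ) (z : Fin n → ℂ) (k : ℕ) :
    symPow B k (vecPow z k) = vecPow (B *ᵥ z) k := by
  ext i
  rw [symPow_apply]
  show _ = ∏ l, ∑ r, B (i l) r * z r
  rw [Finset.prod_univ_sum, Fintype.piFinset_univ]
  refine Finset.sum_congr rfl fun j _ => ?_
  rw [Finset.prod_mul_distrib]
  rfl

theorem comp_expVec_mulVec {n : ℕ} (B : Matrix (Fin n) (Fin n) ℂ) (z : Fin n → ℂ) (k : ℕ) :
    comp k (expVec (B *ᵥ z)) = symPow B k (comp k (expVec z)) := by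
  rw [comp_expVec, comp_expVec, map_smul, symPow_vecPow]

theorem symPow_mul {n : ℕ} (B C : Matrix (Fin n) (Fin n) ℂ) (k : ℕ) (w : symTensor n k) :
    symPow (B * C) k w = symPow B k (symPow C k w) := by
  ext i
  simp only [symPow_apply, Finset.mul_sum]
  rw [Finset.sum_comm]
  refine Finset.sum_congr rfl fun j _ => ?_
  simp only [Matrix.mul_apply]
  rw [Finset.prod_univ_sum, Fintype.piFinset_univ, Finset.sum_mul]
  refine Finset.sum_congr rfl fun m _ => ?_
  rw [Finset.prod_mul_distrib, mul_assoc]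

theorem inner_symPow_left {n : ℕ} (B : Matrix (Fin n) (Fin n) ℂ) (k : ℕ)
    (x y : symTensor n k) : ⟪symPow B k x, y⟫_ℂ = ⟪x, symPow Bᴴ k y⟫_ℂ := by
  simp only [inner_symTensor, symPow_apply, map_sum, map_mul, map_prod, Finset.sum_mul,
    Finset.mul_sum]
  rw [Finset.sum_comm]
  refine Finset.sum_congr rfl fun j _ => Finset.sum_congr rfl fun i _ => ?_
  simp only [Matrix.conjTranspose_apply, RCLike.star_def]
  ring

theorem inner_powKet {n : ℕ} {B C : Matrix (Fin n) (Fin n) ℂ} (h : Cᴴ * C = B)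
    (s s' : MultiIndex n) : ⟪powKet C s, powKet C s'⟫_ℂ = ⟪ket s, powKet B s'⟫_ℂ := by
  unfold powKet ket
  rw [inner_incl_left, inner_incl_left]
  by_cases hd : deg s = deg s'
  · rw [← h, hd, comp_incl_self, comp_incl_self, symPow_mul, inner_symPow_left]
  · rw [comp_incl_ne _ hd, comp_incl_ne _ hd, inner_zero_right, inner_zero_right]

theorem inner_ket_powKet_of_deg_ne {n : ℕ} (B : Matrix (Fin n) (Fin n) ℂ)
    {s s' : MultiIndex n} (h : deg s ≠ deg s') : ⟪ket s, powKet B s'⟫_ℂ = 0 := by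
  unfold powKet ket
  rw [inner_incl_left, comp_incl_ne _ h, inner_zero_right]

theorem secondQuant_ketF {n : ℕ} (B : Matrix (Fin n) (Fin n) ℂ) (s : MultiIndex n) :
    (secondQuant B (ketF s) : Fock n) = powKet B s := by
  refine Fock.ext fun k => ?_
  show symPow B k (comp k (incl (deg s) (ketSym (deg s) s))) = comp k (powKet B s)
  unfold powKet
  by_cases hk : k = deg s
  · subst hk
    rw [comp_incl_self, comp_incl_self]
  · rw [comp_incl_ne _ hk, comp_incl_ne _ hk, map_zero]

/-! ### The exponential of annihilation operators -/

theorem HasPowerSeries.const_mul {n : ℕ} {a : MultiIndex n → ℂ} {F : (Fin n → ℂ) → ℂ}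
    (c : ℂ) (ha : HasPowerSeries a F) :
    HasPowerSeries (fun t => c * a t) (fun z => c * F z) := fun z =>
  hasSum_of_forall_eq (fun _ => mul_assoc _ _ _) ((ha z).mul_left c)

/-- The function `exp(νᵀz + zᵀBz)`. -/
def expQuad {n : ℕ} (ν : Fin n → ℂ) (B : Matrix (Fin n) (Fin n) ℂ) (z : Fin n → ℂ) : ℂ :=
  Complex.exp (ν ⬝ᵥ z + z ⬝ᵥ (B *ᵥ z))

/-- The inner sums in `annihExp` are the Taylor coefficients of the scalar function `exp(νᵀz +
zᵀBz)`. -/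
theorem hasPowerSeries_expQuad {n : ℕ} (ν : Fin n → ℂ) {B : Matrix (Fin n) (Fin n) ℂ}
    (hB : B.IsSymm) :
    HasPowerSeries (fun s => ∑ k ∈ Finset.Iic s,
      (mpow ν k / (mfact k : ℂ)) * (phi B (s - k) / (√(mfact (s - k) : ℝ) : ℂ)))
      (expQuad ν B) := by
  have h := (hasPowerSeries_exp_dotProduct ν).mul (hasPowerSeries_exp_quadratic hB)
  simp only [← Complex.exp_add] at h
  exact h

/-- Only the component of order `deg r` meets `ket r`, so the function is a polynomial and
convergence is immediate. -/
theorem hasPowerSeries_inner_ket_expVec_mulVec {n : ℕ} (C : Matrix (Fin n) (Fin n) ℂ)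
    (r : MultiIndex n) :
    HasPowerSeries (fun t => ⟪ket r, powKet C t⟫_ℂ / (√(mfact t : ℝ) : ℂ))
      (fun z => ⟪ket r, expVec (C *ᵥ z)⟫_ℂ) := by
  intro z
  have h1 : ⟪ket r, expVec (C *ᵥ z)⟫_ℂ = ∑ t ∈ degIndices n (deg r),
      ⟪ket r, powKet C t⟫_ℂ / (√(mfact t : ℝ) : ℂ) * mpow z t := by
    rw [ket, inner_incl_left, comp_expVec_mulVec, comp_expVec_eq_sum_ketSym, map_sum, inner_sum]
    refine Finset.sum_congr rfl fun t ht => ?_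
    rw [map_smul, inner_symTensor_smul_right, inner_incl_left, powKet, mem_degIndices.1 ht,
      comp_incl_self]
    ring
  show HasSum _ ⟪ket r, expVec (C *ᵥ z)⟫_ℂ
  rw [h1]
  refine hasSum_sum_of_ne_finset_zero fun t ht => ?_
  have h2 : deg r ≠ deg t := fun h => ht (mem_degIndices.2 h.symm)
  show ⟪ket r, powKet C t⟫_ℂ / _ * _ = 0
  rw [inner_ket_powKet_of_deg_ne C h2, zero_div, zero_mul]

theorem secondQuant_annihExp_ketF {n : ℕ} (ν : Fin n → ℂ) (B C : Matrix (Fin n) (Fin n) ℂ)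
    (t : MultiIndex n) :
    (secondQuant C (annihExp ν B (ketF t)) : Fock n) =
      (√(mfact t : ℝ) : ℂ) • ∑ s ∈ Finset.Iic t, ∑ k ∈ Finset.Iic s,
      ((mpow ν k / (mfact k : ℂ)) * (phi B (s - k) / (√(mfact (s - k) : ℝ) : ℂ)) /
        (√(mfact (t - s) : ℝ) : ℂ)) • powKet C (t - s) := by
  have h : ketF t = ketBasis n t := (Module.Basis.mk_apply _ _ t).symm
  rw [h, annihExp, Module.Basis.constr_basis]
  simp only [map_smul, map_sum, Submodule.coe_smul, Submodule.coe_sum, secondQuant_ketF]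

/-- For each `r`, the function `⟨r, W e(z)⟩` is expanded twice: through the particle expansion of
`e(z)`, and as a Cauchy product using `hW`. Comparing coefficients of `zᵗ` gives all matrix elements
of `W` at `ket t`. -/
theorem apply_ket_of_apply_expVec {n : ℕ} {W : Fock n →L[ℂ] Fock n} {a : ℂ} {ν : Fin n → ℂ}
    {B C : Matrix (Fin n) (Fin n) ℂ} (hB : B.IsSymm)
    (hW : ∀ z, W (expVec z) = a • expQuad ν B z • expVec (C *ᵥ z)) (t : MultiIndex n) :
    W (ket t) = a • (secondQuant C (annihExp ν B (ketF t)) : Fock n) := by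
  refine eq_of_forall_inner_eq (dense_span_ket n) fun r => ?_
  have h1 := hasHomogeneousSeries_inner_expVec (W.adjoint (ket r))
  have h2 := (((hasPowerSeries_expQuad ν hB).mul
    (hasPowerSeries_inner_ket_expVec_mulVec C r)).const_mul a).hasHomogeneousSeries
  have h3 : (fun z => ⟪W.adjoint (ket r), expVec z⟫_ℂ)
      = fun z => a * (expQuad ν B z * ⟪ket r, expVec (C *ᵥ z)⟫_ℂ) := by
    funext z
    rw [ContinuousLinearMap.adjoint_inner_left, hW, inner_smul_right, inner_smul_right]
  rw [h3] at h1
  have h4 := congrFun (h1.unique h2) t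
  rw [div_eq_iff (sqrt_mfact_ne_zero t), ContinuousLinearMap.adjoint_inner_left] at h4
  rw [h4, secondQuant_annihExp_ketF]
  simp only [inner_smul_right, inner_sum, Finset.sum_mul, Finset.mul_sum]
  refine Finset.sum_congr rfl fun s _ => Finset.sum_congr rfl fun k _ => ?_
  ring

theorem apply_finiteParticle_of_apply_expVec {n : ℕ} {W : Fock n →L[ℂ] Fock n} {a : ℂ}
    {ν : Fin n → ℂ} {B C : Matrix (Fin n) (Fin n) ℂ} (hB : B.IsSymm)
    (hW : ∀ z, W (expVec z) = a • expQuad ν B z • expVec (C *ᵥ z)) (ψ : finiteParticle n) :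
    W ψ = a • (secondQuant C (annihExp ν B ψ) : Fock n) := by
  have h : W.toLinearMap ∘ₗ (finiteParticle n).subtype
      = a • ((finiteParticle n).subtype ∘ₗ secondQuant C ∘ₗ annihExp ν B) := by
    refine (ketBasis n).ext fun t => ?_
    rw [show ketBasis n t = ketF t from Module.Basis.mk_apply _ _ t]
    exact apply_ket_of_apply_expVec hB hW t
  exact LinearMap.congr_fun h ψ

/-! ### Positive operators of the class `𝓔₂` -/

theorem isSymm_conjMat {n : ℕ} {A : Matrix (Fin n) (Fin n) ℂ} (hA : A.IsSymm) :
    (conjMat A).IsSymm := by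
  rw [Matrix.IsSymm, conjMat, ← Matrix.transpose_map, hA]

theorem conj_dotProduct_star {n : ℕ} (μ u : Fin n → ℂ) :
    (starRingEnd ℂ) (star μ ⬝ᵥ u) = star u ⬝ᵥ μ := by
  simp [dotProduct, mul_comm]

theorem conj_dotProduct_conjMat {n : ℕ} (A : Matrix (Fin n) (Fin n) ℂ) (u : Fin n → ℂ) :
    (starRingEnd ℂ) (u ⬝ᵥ (conjMat A *ᵥ u)) = star u ⬝ᵥ (A *ᵥ star u) := by
  simp [dotProduct, Matrix.mulVec, conjMat]

theorem inner_expVec_apply_expVec {n : ℕ} {Z : Fock n →L[ℂ] Fock n} {c : ℝ}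
    {μ : Fin n → ℂ} {A Λ : Matrix (Fin n) (Fin n) ℂ}
    (hpar : HasE2Params Z (c : ℂ) μ (star μ) A Λ (conjMat A)) (u v : Fin n → ℂ) :
    ⟪expVec u, Z (expVec v)⟫_ℂ = c * ((starRingEnd ℂ) (expQuad (star μ) (conjMat A) u) *
      expQuad (star μ) (conjMat A) v * Complex.exp (star u ⬝ᵥ (Λ *ᵥ v))) := by
  rw [← genFun_eq_inner, hpar.genFun_eq, expQuad, expQuad, ← Complex.exp_conj, map_add,
    conj_dotProduct_star, conj_dotProduct_conjMat, ← Complex.exp_add, ← Complex.exp_add]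
  congr 2
  ring

/-- `w` is the right derivative at 0 of `exp(x w)`, a limit of nonnegative difference quotients; `ε
= √x` matches the hypothesis. -/
theorem nonneg_of_forall_exp_sub_one_nonneg {w : ℂ}
    (h : ∀ ε : ℝ, 0 < ε → 0 ≤ Complex.exp ((ε : ℂ) ^ 2 * w) - 1) : 0 ≤ w := by
  have h1 : HasDerivAt (fun x : ℝ => Complex.exp ((x : ℂ) * w)) w 0 := by
    have h2 : HasDerivAt (fun x : ℝ => (x : ℂ) * w) w 0 := by
      simpa using (Complex.ofRealCLM.hasDerivAt (x := (0 : ℝ))).mul_const w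
    simpa using h2.cexp
  refine ge_of_tendsto h1.tendsto_slope_zero_right ?_
  filter_upwards [self_mem_nhdsWithin] with x hx
  have hx' : 0 < x := hx
  have h3 := h (√x) (Real.sqrt_pos.2 hx')
  rw [← Complex.ofReal_pow, Real.sq_sqrt hx'.le] at h3
  simp only [zero_add, Complex.ofReal_zero, zero_mul, Complex.exp_zero]
  exact smul_nonneg (inv_nonneg.2 hx'.le) h3

theorem HasE2Params.posSemidef {n : ℕ} {Z : Fock n →L[ℂ] Fock n} (hZ : Z.IsPositive) {c : ℝ}
    (hc : 0 < c) {μ : Fin n → ℂ} {A Λ : Matrix (Fin n) (Fin n) ℂ}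
    (hpar : HasE2Params Z (c : ℂ) μ (star μ) A Λ (conjMat A)) : Λ.PosSemidef := by
  have hquad : ∀ u : Fin n → ℂ, 0 ≤ star u ⬝ᵥ (Λ *ᵥ u) := by
    intro u
    refine nonneg_of_forall_exp_sub_one_nonneg fun ε _ => ?_
    set f := expQuad (star μ) (conjMat A) with hf
    have hf0 : f 0 = 1 := by simp [hf, expQuad]
    set v : Fin n → ℂ := (ε : ℂ) • u with hv
    have hfv : f v ≠ 0 := Complex.exp_ne_zero _
    have hfv' : (starRingEnd ℂ) (f v) ≠ 0 := (map_ne_zero _).2 hfv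
    have hvv : star v ⬝ᵥ (Λ *ᵥ v) = (ε : ℂ) ^ 2 * (star u ⬝ᵥ (Λ *ᵥ u)) := by
      rw [hv, star_smul, Matrix.mulVec_smul, smul_dotProduct, dotProduct_smul]
      simp only [RCLike.star_def, Complex.conj_ofReal, smul_eq_mul]
      ring
    -- Dividing by `f v` cancels the linear and quadratic factors of the kernel. The four terms are
    -- then `c` times `exp(v†Λv) - 1 - 1 + 1`.
    have h1 := hZ.inner_nonneg_right ((f v)⁻¹ • expVec v - expVec 0)
    simp only [map_sub, map_smul, inner_sub_left, inner_sub_right, inner_smul_left,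
      inner_smul_right, inner_expVec_apply_expVec hpar, ← hf, hf0, hvv] at h1
    have h2 : (0 : ℂ) ≤ c * (Complex.exp ((ε : ℂ) ^ 2 * (star u ⬝ᵥ (Λ *ᵥ u))) - 1) := by
      convert h1 using 1
      simp only [map_inv₀, map_one, star_zero, zero_dotProduct, Matrix.mulVec_zero,
        dotProduct_zero, Complex.exp_zero]
      field_simp
      ring
    have h3 := smul_nonneg (inv_nonneg.2 hc.le) h2
    rwa [Complex.real_smul, ← mul_assoc, ← Complex.ofReal_mul, inv_mul_cancel₀ hc.ne',
      Complex.ofReal_one, one_mul] at h3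
  -- Over `ℂ`, a quadratic form with real nonnegative values already forces the matrix to be
  -- Hermitian.
  rw [← Matrix.isPositive_toEuclideanLin_iff, LinearMap.isPositive_iff_complex]
  intro x
  have h1 : ⟪Λ.toEuclideanLin x, x⟫_ℂ = star (star x.ofLp ⬝ᵥ (Λ *ᵥ x.ofLp)) := by
    rw [← inner_conj_symm, EuclideanSpace.inner_eq_star_dotProduct, dotProduct_comm]
    rfl
  obtain ⟨h2, h3⟩ := Complex.nonneg_iff.1 (hquad x.ofLp)
  rw [h1]
  refine ⟨Complex.ext ?_ ?_, ?_⟩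
  · simp
  · simp [← h3]
  · simpa using h2

theorem conjTranspose_sqrt_mul_sqrt {n : ℕ} {Λ : Matrix (Fin n) (Fin n) ℂ}
    (hΛ : Λ.PosSemidef) : (CFC.sqrt Λ)ᴴ * CFC.sqrt Λ = Λ := by
  have h1 : (CFC.sqrt Λ)ᴴ = CFC.sqrt Λ := (CFC.sqrt_nonneg Λ).isSelfAdjoint
  rw [h1, CFC.sqrt_mul_sqrt_self Λ (Matrix.nonneg_iff_posSemidef.2 hΛ)]

theorem HasE2Params.exists_sqrt_factor {n : ℕ} {Z : Fock n →L[ℂ] Fock n} (hZ : Z.IsPositive)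
    {c : ℝ} (hc : 0 < c) {μ : Fin n → ℂ} {A Λ : Matrix (Fin n) (Fin n) ℂ}
    (hpar : HasE2Params Z (c : ℂ) μ (star μ) A Λ (conjMat A)) :
    ∃ W : Fock n →L[ℂ] Fock n,
      (∀ z, W (expVec z) = (√c : ℂ) • expQuad (star μ) (conjMat A) z •
        expVec (CFC.sqrt Λ *ᵥ z)) ∧ Z = W.adjoint ∘L W := by
  have hS := conjTranspose_sqrt_mul_sqrt (hpar.posSemidef hZ hc)
  refine exists_adjoint_comp_self_of_gram Z (dense_span_expVec n) fun u v => ?_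
  rw [inner_expVec_apply_expVec hpar, inner_smul_left, inner_smul_left, inner_smul_right,
    inner_smul_right, inner_expVec, Complex.conj_ofReal, ← ofReal_sqrt_mul_self hc.le,
    Matrix.star_mulVec, Matrix.dotProduct_mulVec, Matrix.vecMul_vecMul, hS,
    ← Matrix.dotProduct_mulVec]
  ring

/-! ### The operator on the span of the finite particle and exponential vectors -/

theorem IsWickOperator.apply_eq {n : ℕ} {c : ℝ} {μ : Fin n → ℂ}
    {A Λ : Matrix (Fin n) (Fin n) ℂ} {T : Fock n →ₗ.[ℂ] Fock n}
    (hT : IsWickOperator c μ A Λ T) (hA : A.IsSymm) {W : Fock n →L[ℂ] Fock n}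
    (hW : ∀ z, W (expVec z) = (√c : ℂ) • expQuad (star μ) (conjMat A) z •
      expVec (CFC.sqrt Λ *ᵥ z)) (x : T.domain) : T x = W x := by
  have h : ∀ x ∈ Submodule.span ℂ ((finiteParticle n : Set (Fock n)) ∪
      Set.range (expVec (n := n))), ∀ h : x ∈ T.domain, T ⟨x, h⟩ = W x := by
    intro x hx
    induction hx using Submodule.span_induction with
    | mem y hy =>
      intro h
      rcases hy with hy | ⟨z, rfl⟩
      · exact (hT.on_finiteParticle ⟨y, hy⟩ h).trans
          (apply_finiteParticle_of_apply_expVec (isSymm_conjMat hA) hW ⟨y, hy⟩).symm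
      · exact (hT.on_expVec z h).trans (hW z).symm
    | zero =>
      intro h
      rw [map_zero]
      exact T.map_zero
    | add a b ha hb iha ihb =>
      intro h
      rw [← hT.domain_eq] at ha hb
      rw [map_add, ← iha ha, ← ihb hb]
      exact T.map_add ⟨a, ha⟩ ⟨b, hb⟩
    | smul r a ha iha =>
      intro h
      rw [← hT.domain_eq] at ha
      rw [map_smul, ← iha ha]
      exact T.map_smul r ⟨a, ha⟩
  exact h x (hT.domain_eq ▸ x.2) x.2

/-- Consistency of the two prescriptions under linear relations is automatic, since both are values
of the single operator `W`. -/
theorem isWickOperator_toPMap {n : ℕ} {c : ℝ} {μ : Fin n → ℂ}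
    {A Λ : Matrix (Fin n) (Fin n) ℂ} (hA : A.IsSymm) {W : Fock n →L[ℂ] Fock n}
    (hW : ∀ z, W (expVec z) = (√c : ℂ) • expQuad (star μ) (conjMat A) z •
      expVec (CFC.sqrt Λ *ᵥ z)) :
    IsWickOperator c μ A Λ (W.toLinearMap.toPMap (Submodule.span ℂ
      ((finiteParticle n : Set (Fock n)) ∪ Set.range (expVec (n := n))))) where
  domain_eq := rfl
  on_finiteParticle ψ _ := apply_finiteParticle_of_apply_expVec (isSymm_conjMat hA) hW ψ
  on_expVec z _ := hW z

theorem IsWickOperator.eq {n : ℕ} {c : ℝ} {μ : Fin n → ℂ} {A Λ : Matrix (Fin n) (Fin n) ℂ}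
    {T T' : Fock n →ₗ.[ℂ] Fock n} (hT : IsWickOperator c μ A Λ T)
    (hT' : IsWickOperator c μ A Λ T') (hA : A.IsSymm) {W : Fock n →L[ℂ] Fock n}
    (hW : ∀ z, W (expVec z) = (√c : ℂ) • expQuad (star μ) (conjMat A) z •
      expVec (CFC.sqrt Λ *ᵥ z)) : T = T' :=
  LinearPMap.ext (hT.domain_eq.trans hT'.domain_eq.symm) fun x hx hx' =>
    (hT.apply_eq hA hW ⟨x, hx⟩).trans (hT'.apply_eq hA hW ⟨x, hx'⟩).symm

theorem IsWickOperator.dense_domain {n : ℕ} {c : ℝ} {μ : Fin n → ℂ}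
    {A Λ : Matrix (Fin n) (Fin n) ℂ} {T : Fock n →ₗ.[ℂ] Fock n}
    (hT : IsWickOperator c μ A Λ T) : Dense (T.domain : Set (Fock n)) := by
  rw [hT.domain_eq]
  exact (dense_span_expVec n).mono (Submodule.span_mono Set.subset_union_right)

theorem hasE2Params_of_apply_expVec {n : ℕ} {a : ℂ} {ν : Fin n → ℂ}
    {B C : Matrix (Fin n) (Fin n) ℂ} (hB : B.IsSymm) {W : Fock n →L[ℂ] Fock n}
    (hW : ∀ z, W (expVec z) = a • expQuad ν B z • expVec (C *ᵥ z)) :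
    HasE2Params W a 0 ν 0 C B where
  symm_A := Matrix.isSymm_zero
  symm_B := hB
  genFun_eq u v := by
    rw [genFun, hW, inner_smul_right, inner_smul_right, inner_expVec, star_star, expQuad,
      ← Complex.exp_add, dotProduct_zero, Matrix.zero_mulVec, dotProduct_zero]
    congr 2
    ring

/-! ### Matrix elements in the particle basis -/

theorem mchoose_mul_mfact {n : ℕ} {t s : MultiIndex n} (h : s ≤ t) :
    mchoose t s * mfact s * mfact (t - s) = mfact t := by
  simp only [mchoose, mfact, ← Finset.prod_mul_distrib]
  exact Finset.prod_congr rfl fun i _ => Nat.choose_mul_factorial_mul_factorial (h i)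

theorem sqrt_mchoose {n : ℕ} {t s : MultiIndex n} (h : s ≤ t) :
    (√(mchoose t s : ℝ) : ℂ) * (√(mfact s : ℝ) : ℂ) * (√(mfact (t - s) : ℝ) : ℂ)
      = (√(mfact t : ℝ) : ℂ) := by
  rw [← mchoose_mul_mfact h]
  push_cast
  rw [Real.sqrt_mul (by positivity), Real.sqrt_mul (by positivity)]
  push_cast
  rfl

theorem phi_conjMat {n : ℕ} (A : Matrix (Fin n) (Fin n) ℂ) (t : MultiIndex n) :
    phi (conjMat A) t = (starRingEnd ℂ) (phi A t) := by
  simp [phi, conjMat, map_sum, map_prod, map_ofNat (starRingEnd ℂ) 2]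

theorem mpow_zero_eq_zero {n : ℕ} {k : MultiIndex n} (hk : k ≠ 0) :
    mpow (0 : Fin n → ℂ) k = 0 := by
  obtain ⟨i, hi⟩ := Function.ne_iff.1 hk
  exact Finset.prod_eq_zero (Finset.mem_univ i) (zero_pow hi)

theorem secondQuant_annihExp_zero_ketF {n : ℕ} (B C : Matrix (Fin n) (Fin n) ℂ)
    (t : MultiIndex n) :
    (secondQuant C (annihExp 0 B (ketF t)) : Fock n) = ∑ s ∈ Finset.Iic t,
      ((√(mchoose t s : ℝ) : ℂ) * phi B (t - s)) • powKet C s := by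
  rw [secondQuant_annihExp_ketF, Finset.smul_sum]
  -- In `annihExp` the index `s` counts removed particles, here it counts the remaining ones. With
  -- zero linear part, only `k = 0` survives in the inner sum.
  refine Finset.sum_nbij' (fun s => t - s) (fun s => t - s)
    (fun s _ => Finset.mem_Iic.2 tsub_le_self) (fun s _ => Finset.mem_Iic.2 tsub_le_self)
    (fun s hs => tsub_tsub_cancel_of_le (Finset.mem_Iic.1 hs))
    (fun s hs => tsub_tsub_cancel_of_le (Finset.mem_Iic.1 hs)) fun s hs => ?_
  have hs' : s ≤ t := Finset.mem_Iic.1 hs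
  have h0 : mpow (0 : Fin n → ℂ) (0 : MultiIndex n) = 1 := by simp [mpow]
  have h1 : mfact (0 : MultiIndex n) = 1 := by simp [mfact]
  rw [Finset.sum_eq_single (0 : MultiIndex n), smul_smul, tsub_tsub_cancel_of_le hs', h0, h1,
    tsub_zero, ← sqrt_mchoose (tsub_le_self : t - s ≤ t), tsub_tsub_cancel_of_le hs']
  · congr 1
    have h2 := sqrt_mfact_ne_zero s
    have h3 := sqrt_mfact_ne_zero (t - s)
    push_cast
    field_simp
  · intro k _ hk
    rw [mpow_zero_eq_zero hk]
    simp
  · intro h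
    exact absurd (Finset.mem_Iic.2 zero_le) h

theorem inner_ket_adjoint_comp_self {n : ℕ} {W : Fock n →L[ℂ] Fock n} {c : ℝ} (hc : 0 ≤ c)
    {A C Λ : Matrix (Fin n) (Fin n) ℂ} (hC : Cᴴ * C = Λ)
    (hW : ∀ t, W (ket t) = (√c : ℂ) • ∑ s ∈ Finset.Iic t,
      ((√(mchoose t s : ℝ) : ℂ) * phi (conjMat A) (t - s)) • powKet C s) (t t' : MultiIndex n) :
    ⟪ket t, (W.adjoint ∘L W) (ket t')⟫_ℂ = (c : ℂ) *
      ∑ s ∈ Finset.Iic t, ∑ s' ∈ Finset.Iic t',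
        (√(mchoose t s : ℝ) : ℂ) * phi A (t - s) * ⟪ket s, powKet Λ s'⟫_ℂ *
          (√(mchoose t' s' : ℝ) : ℂ) * (starRingEnd ℂ) (phi A (t' - s')) := by
  rw [ContinuousLinearMap.comp_apply, ContinuousLinearMap.adjoint_inner_right, hW, hW,
    inner_smul_left, inner_smul_right, Complex.conj_ofReal, ← mul_assoc,
    ofReal_sqrt_mul_self hc, sum_inner]
  congr 1
  refine Finset.sum_congr rfl fun s _ => ?_
  rw [inner_sum]
  refine Finset.sum_congr rfl fun s' _ => ?_
  rw [inner_smul_left, inner_smul_right, inner_powKet hC, phi_conjMat, phi_conjMat, map_mul,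
    Complex.conj_ofReal, Complex.conj_conj]
  ring

theorem eMatrix_of_le {n : ℕ} (A : Matrix (Fin n) (Fin n) ℂ) {t s : MultiIndex n}
    (h : s ≤ t) : eMatrix A t s = (√(mchoose t s : ℝ) : ℂ) * phi A (t - s) :=
  if_pos h

theorem eMatrix_of_notMem {n : ℕ} (A : Matrix (Fin n) (Fin n) ℂ) {t s : MultiIndex n}
    (h : s ∉ Finset.Iic t) : eMatrix A t s = 0 :=
  if_neg fun h' => h (Finset.mem_Iic.2 h')

/-- Row `t` of `eMatrix A` is supported on the finite set of `s ≤ t`, so both infinite products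
reduce to finite sums. -/
theorem infMul_eMatrix_gammaMatrix {n : ℕ} (A Λ : Matrix (Fin n) (Fin n) ℂ)
    (t t' : MultiIndex n) :
    infMul (infMul (eMatrix A) (gammaMatrix Λ)) (eMatrix A)ᴴ t t' =
      ∑ s ∈ Finset.Iic t, ∑ s' ∈ Finset.Iic t',
        (√(mchoose t s : ℝ) : ℂ) * phi A (t - s) * ⟪ket s, powKet Λ s'⟫_ℂ *
          (√(mchoose t' s' : ℝ) : ℂ) * (starRingEnd ℂ) (phi A (t' - s')) := by
  have h1 : ∀ s', infMul (eMatrix A) (gammaMatrix Λ) t s'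
      = ∑ s ∈ Finset.Iic t, eMatrix A t s * gammaMatrix Λ s s' := fun s' =>
    tsum_eq_sum fun s hs => by rw [eMatrix_of_notMem A hs, zero_mul]
  have h2 : infMul (infMul (eMatrix A) (gammaMatrix Λ)) (eMatrix A)ᴴ t t'
      = ∑ s' ∈ Finset.Iic t', infMul (eMatrix A) (gammaMatrix Λ) t s' * (eMatrix A)ᴴ s' t' :=
    tsum_eq_sum fun s' hs' => by
      rw [Matrix.conjTranspose_apply, eMatrix_of_notMem A hs', star_zero, mul_zero]
  rw [h2, Finset.sum_comm]
  refine Finset.sum_congr rfl fun s' hs' => ?_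
  rw [h1, Finset.sum_mul]
  refine Finset.sum_congr rfl fun s hs => ?_
  have h3 : gammaMatrix Λ s s' = ⟪ket s, powKet Λ s'⟫_ℂ := by
    rw [← secondQuant_ketF]
    rfl
  rw [h3, Matrix.conjTranspose_apply, eMatrix_of_le A (Finset.mem_Iic.1 hs),
    eMatrix_of_le A (Finset.mem_Iic.1 hs'), RCLike.star_def, map_mul, Complex.conj_ofReal]
  ring

end BosonFock

end

theorem mainTheorem4 (n : ℕ) (Z : Fock n →L[ℂ] Fock n) (hZ : Z.IsPositive)
    (c : ℝ) (hc : 0 < c) (μ : Fin n → ℂ) (A Λ : Matrix (Fin n) (Fin n) ℂ)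
    (hpar : HasE2Params Z (c : ℂ) μ (star μ) A Λ (conjMat A)) :
    Λ.PosSemidef ∧
    (∃! T : Fock n →ₗ.[ℂ] Fock n, IsWickOperator c μ A Λ T) ∧
    ∀ T : Fock n →ₗ.[ℂ] Fock n, IsWickOperator c μ A Λ T →
      T.IsClosable ∧
      ∃ Z₁ : Fock n →L[ℂ] Fock n,
        T.closure = Z₁.toLinearMap.toPMap ⊤ ∧
        HasE2Params Z₁ (√c : ℂ) 0 (star μ) 0 (CFC.sqrt Λ) (conjMat A) ∧
        Z = Z₁.adjoint ∘L Z₁ ∧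
        (∃ V : Fock n →L[ℂ] Fock n, IsPartialIsometry V ∧ Z₁ = V ∘L CFC.sqrt Z) ∧
        (IsTraceClass Z ↔ IsHilbertSchmidt Z₁) ∧
        (μ = 0 →
          (∀ t : MultiIndex n, Z₁ (ket t) = (√c : ℂ) • ∑ s ∈ Finset.Iic t,
            ((√(mchoose t s : ℝ) : ℂ) * phi (conjMat A) (t - s)) • powKet (CFC.sqrt Λ) s) ∧
          (∀ t t' : MultiIndex n, ⟪ket t, Z (ket t')⟫_ℂ = (c : ℂ) *
            ∑ s ∈ Finset.Iic t, ∑ s' ∈ (Finset.Iic t').filter (fun s' => deg s = deg s'),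
              (√(mchoose t s : ℝ) : ℂ) * phi A (t - s) * ⟪ket s, powKet Λ s'⟫_ℂ *
                (√(mchoose t' s' : ℝ) : ℂ) * (starRingEnd ℂ) (phi A (t' - s'))) ∧
          boundedMatrix Z
            = (c : ℂ) • infMul (infMul (eMatrix A) (gammaMatrix Λ)) (eMatrix A)ᴴ) := by
  have hΛ := hpar.posSemidef hZ hc
  have hA := hpar.symm_A
  obtain ⟨W, hW, hZW⟩ := hpar.exists_sqrt_factor hZ hc
  refine ⟨hΛ, ⟨_, isWickOperator_toPMap hA hW, fun T hT =>
    hT.eq (isWickOperator_toPMap hA hW) hA hW⟩, fun T hT => ?_⟩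
  obtain ⟨hcl, hclosure⟩ := isClosable_and_closure_eq_toPMap hT.dense_domain
    (hT.apply_eq hA hW)
  refine ⟨hcl, W, hclosure, hasE2Params_of_apply_expVec hpar.symm_B hW, hZW,
    exists_partialIsometry_comp_sqrt hZ hZW, isTraceClass_iff_isHilbertSchmidt hZ hZW, ?_⟩
  rintro rfl
  rw [star_zero] at hW
  have hket : ∀ t : MultiIndex n, W (ket t) = (√c : ℂ) • ∑ s ∈ Finset.Iic t,
      ((√(mchoose t s : ℝ) : ℂ) * phi (conjMat A) (t - s)) • powKet (CFC.sqrt Λ) s := by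
    intro t
    rw [apply_ket_of_apply_expVec hpar.symm_B hW, secondQuant_annihExp_zero_ketF]
  have hinner := inner_ket_adjoint_comp_self hc.le (conjTranspose_sqrt_mul_sqrt hΛ) hket
  rw [← hZW] at hinner
  refine ⟨hket, fun t t' => ?_, ?_⟩
  · rw [hinner]
    congr 1
    refine Finset.sum_congr rfl fun s _ => ?_
    -- Vectors of different particle number are orthogonal, so the restriction to equal degrees
    -- removes only zero terms.
    rw [Finset.sum_filter]
    refine Finset.sum_congr rfl fun s' _ => ?_
    split_ifs with h
    · rfl
    · rw [inner_ket_powKet_of_deg_ne Λ h]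
      ring
  · ext t t'
    rw [Matrix.smul_apply, infMul_eMatrix_gammaMatrix, smul_eq_mul, ← hinner]
    rfl
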